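/- Let $d\in\{2,3\}$, let $\Omega\subset\mathbb R^d$ be a bounded connected Lipschitz domain, and let $\sigma>0$. There is a constant $C$, depending only on $\Omega$ and $\sigma$, such that the following holds. Let $\mathcal T_h$ be any conforming simplicial mesh of $\overline\Omega$ (so $\overline\Omega$ is the union of the closed simplices $K\in\mathcal T_h$) which is shape regular with constant $\sigma$, i.e. for every $K$ the ratio of the diameter of $K$ to the diameter of its largest inscribed ball is at most $\sigma$. Let $h$ be the maximum of the diameters of the simplices, let $x_1,\dots,x_M$ be the nodes (all vertices of the simplices, including those on $\partial\Omega$), let $\phi_i$ be the continuous piecewise affine Lagrange basis function of $x_i$, let $\Delta_i$ be the union of the simplices that have $x_i$ as a vertex, and put $$c_{ij}=\int_{\Delta_i\cap\Delta_j}|\nabla\phi_i\cdot\nabla\phi_j| .$$ Assume that the mesh satisfies the angle condition $$\int_K\nabla\phi_i\cdot\nabla\phi_j\le 0\qquad\text{for all }K\in\mathcal T_h\text{ and all } i\neq j .$$ Let $u,v\in H^2(\Omega)$ and $w\in W^{1,\infty}(\Omega)$. Then $u$, $v$, $w$ have continuous representatives on $\overline\Omega$; denote by $U^i=u(x_i)$,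 $V^i=v(x_i)$ the nodal values. For every choice of numbers $\tilde W^{ij}$ such that, whenever $x_i\ne x_j$ are the end points of an edge $e_{ij}=[x_i,x_j]$ of the mesh, $\tilde W^{ij}=\tilde W^{ji}$ and $\tilde W^{ij}$ is the value of $w$ at some point of $e_{ij}$ (the other $\tilde W^{ij}$ are irrelevant), one has $$\int_\Omega w\,\nabla u\cdot\nabla v=-\sum_{i,j=1}^M U^i\,c_{ij}\,\tilde W^{ij}\,(V^j-V^i)+R,$$ $$|R|\le C\,h\,\|w\|_{W^{1,\infty}(\Omega)}\,\|u\|_{H^2(\Omega)}\,\|v\|_{H^2(\Omega)},$$ where $\|w\|_{W^{1,\infty}(\Omega)}=\|w\|_{L^\infty(\Omega)}+\|\nabla w\|_{L^\infty(\Omega)}$ is the full norm. -/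

import Mathlib

open MeasureTheory Set
open scoped ENNReal ContDiff Gradient

noncomputable section

/-! ### Domains -/

/-- A bounded connected Lipschitz domain of `ℝ^d`: a bounded connected open set which, near each
boundary point and in a suitable orthonormal system of coordinates, is the strict epigraph of a
Lipschitz function. The last coordinate axis is directed by the unit vector `n`, the vector
`y - ⟪n, y⟫ n` stands for the remaining coordinates. -/
structure IsLipschitzDomain {d : ℕ} (Ω : Set (EuclideanSpace ℝ (Fin d))) : Prop where
  isOpen : IsOpen Ω
  isConnected : IsConnected Ω
  isBounded : Bornology.IsBounded Ω
  locally_epigraph : ∀ x ∈ frontier Ω, ∃ (r : ℝ) (n : EuclideanSpace ℝ (Fin d)) (L : NNReal)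
    (γ : EuclideanSpace ℝ (Fin d) → ℝ), 0 < r ∧ ‖n‖ = 1 ∧ LipschitzWith L γ ∧
      ∀ y ∈ Metric.ball x r, y ∈ Ω ↔ γ (y - inner ℝ n y • n) < inner ℝ n y

/-! ### Sobolev spaces -/

/-- `g` is the weak partial derivative `∂f/∂xᵢ` on the open set `Ω`. -/
def HasWeakPartial {d : ℕ} (Ω : Set (EuclideanSpace ℝ (Fin d))) (i : Fin d)
    (f g : EuclideanSpace ℝ (Fin d) → ℝ) : Prop :=
  LocallyIntegrableOn f Ω ∧ LocallyIntegrableOn g Ω ∧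
    ∀ φ : EuclideanSpace ℝ (Fin d) → ℝ, ContDiff ℝ ∞ φ → HasCompactSupport φ → tsupport φ ⊆ Ω →
      ∫ x in Ω, f x * fderiv ℝ φ x (EuclideanSpace.single i 1) = - ∫ x in Ω, g x * φ x

open Classical in
/-- The weak partial derivative `∂f/∂xᵢ` on `Ω` (unique almost everywhere in `Ω`), or `0` if there
is none. -/
def weakPartial {d : ℕ} (Ω : Set (EuclideanSpace ℝ (Fin d))) (i : Fin d)
    (f : EuclideanSpace ℝ (Fin d) → ℝ) : EuclideanSpace ℝ (Fin d) → ℝ :=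
  if h : ∃ g, HasWeakPartial Ω i f g then h.choose else 0

/-- The weak gradient. -/
def weakGrad {d : ℕ} (Ω : Set (EuclideanSpace ℝ (Fin d))) (f : EuclideanSpace ℝ (Fin d) → ℝ)
    (x : EuclideanSpace ℝ (Fin d)) : EuclideanSpace ℝ (Fin d) :=
  WithLp.toLp 2 fun i => weakPartial Ω i f x

/-- The norm of `L^p(Ω)`. -/
def lpNormOn {d : ℕ} {F : Type*} [NormedAddCommGroup F] (Ω : Set (EuclideanSpace ℝ (Fin d)))
    (p : ℝ≥0∞) (f : EuclideanSpace ℝ (Fin d) → F) : ℝ :=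
  (eLpNorm f p (volume.restrict Ω)).toReal

/-- `f` belongs to `H²(Ω)`: it has weak partial derivatives of order one and two on `Ω`, and these
belong to `L²(Ω)`, together with `f`. -/
def MemH2 {d : ℕ} (Ω : Set (EuclideanSpace ℝ (Fin d))) (f : EuclideanSpace ℝ (Fin d) → ℝ) :
    Prop :=
  MemLp f 2 (volume.restrict Ω) ∧
  (∀ i, HasWeakPartial Ω i f (weakPartial Ω i f) ∧
    MemLp (weakPartial Ω i f) 2 (volume.restrict Ω)) ∧
  (∀ i j, HasWeakPartial Ω j (weakPartial Ω i f) (weakPartial Ω j (weakPartial Ω i f)) ∧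
    MemLp (weakPartial Ω j (weakPartial Ω i f)) 2 (volume.restrict Ω))

/-- The norm of `H²(Ω)`. -/
def normH2 {d : ℕ} (Ω : Set (EuclideanSpace ℝ (Fin d))) (f : EuclideanSpace ℝ (Fin d) → ℝ) : ℝ :=
  Real.sqrt (lpNormOn Ω 2 f ^ 2 + ∑ i, lpNormOn Ω 2 (weakPartial Ω i f) ^ 2 +
    ∑ i, ∑ j, lpNormOn Ω 2 (weakPartial Ω j (weakPartial Ω i f)) ^ 2)

/-- `f` belongs to `W^{1,∞}(Ω)`. -/
def MemW1Inf {d : ℕ} (Ω : Set (EuclideanSpace ℝ (Fin d))) (f : EuclideanSpace ℝ (Fin d) → ℝ) :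
    Prop :=
  MemLp f ∞ (volume.restrict Ω) ∧
  ∀ i, HasWeakPartial Ω i f (weakPartial Ω i f) ∧
    MemLp (weakPartial Ω i f) ∞ (volume.restrict Ω)

/-- The norm of `W^{1,∞}(Ω)`: the sum of the `L^∞` norms of the function and of its gradient. -/
def normW1Inf {d : ℕ} (Ω : Set (EuclideanSpace ℝ (Fin d))) (f : EuclideanSpace ℝ (Fin d) → ℝ) :
    ℝ :=
  lpNormOn Ω ∞ f + lpNormOn Ω ∞ (weakGrad Ω f)

/-- `f'` is the continuous representative on the closure of `Ω` of the class of `f`. Its values on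
the closure of an open set `Ω` are determined by the class of `f`. -/
def IsContRep {d : ℕ} (Ω : Set (EuclideanSpace ℝ (Fin d)))
    (f f' : EuclideanSpace ℝ (Fin d) → ℝ) : Prop :=
  ContinuousOn f' (closure Ω) ∧ f' =ᵐ[volume.restrict Ω] f

/-! ### Meshes -/

/-- A conforming simplicial mesh of `Ω ⊆ ℝ^d`: a finite simplicial complex, all of whose faces are
faces of `d`-simplices, and whose underlying space is the closure of `Ω`. A simplex is represented
by the finite set of its vertices. -/
structure SimplicialMesh {d : ℕ} (Ω : Set (EuclideanSpace ℝ (Fin d))) extends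
    Geometry.SimplicialComplex ℝ (EuclideanSpace ℝ (Fin d)) where
  finite_faces : faces.Finite
  pure : ∀ s ∈ faces, ∃ t ∈ faces, s ⊆ t ∧ t.card = d + 1
  space_eq : toSimplicialComplex.space = closure Ω

namespace SimplicialMesh

variable {d : ℕ} {Ω : Set (EuclideanSpace ℝ (Fin d))} (T : SimplicialMesh Ω)

open Classical in
/-- The elements `K` of the mesh (each given by its `d + 1` vertices). -/
def cells : Finset (Finset (EuclideanSpace ℝ (Fin d))) :=
  {K ∈ T.finite_faces.toFinset | K.card = d + 1}

open Classical in
/-- The nodes of the mesh. A node is used as its own index. -/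
def nodes : Finset (EuclideanSpace ℝ (Fin d)) := T.cells.biUnion id

variable {T} in
theorem mem_cells {K : Finset (EuclideanSpace ℝ (Fin d))} :
    K ∈ T.cells ↔ K ∈ T.faces ∧ K.card = d + 1 := by
  simp [cells]

/-- The vertices of an element form an affine basis of `ℝ^d`. -/
def cellBasis {K : Finset (EuclideanSpace ℝ (Fin d))} (hK : K ∈ T.cells) :
    AffineBasis K ℝ (EuclideanSpace ℝ (Fin d)) where
  toFun := (↑)
  ind' := T.indep (mem_cells.1 hK).1
  tot' := by
    rw [(T.indep (mem_cells.1 hK).1).affineSpan_eq_top_iff_card_eq_finrank_add_one]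
    simpa using (mem_cells.1 hK).2

open Classical in
/-- The Lagrange basis function `φᵢ` of the node `i`: on each element that has `i` as a vertex it
is the barycentric coordinate of that vertex, and it vanishes elsewhere. Thus it is continuous on
the closure of `Ω`, affine on each element, takes the value `1` at the node `i` and the value `0`
at the other nodes. -/
def hat (i x : EuclideanSpace ℝ (Fin d)) : ℝ :=
  if h : ∃ K, ∃ _ : K ∈ T.cells, ∃ _ : i ∈ K,
      x ∈ convexHull ℝ (K : Set (EuclideanSpace ℝ (Fin d)))
  then (T.cellBasis h.choose_spec.choose).coord ⟨i, h.choose_spec.choose_spec.choose⟩ x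
  else 0

/-- `Δᵢ`, the union of the elements sharing the node `i`. -/
def patch (i : EuclideanSpace ℝ (Fin d)) : Set (EuclideanSpace ℝ (Fin d)) :=
  ⋃ K ∈ T.cells, ⋃ _ : i ∈ K, convexHull ℝ (K : Set (EuclideanSpace ℝ (Fin d)))

/-- The coefficient `c_{ij} = ∫_{Δᵢ ∩ Δⱼ} |∇φᵢ · ∇φⱼ|`. -/
def coeff (i j : EuclideanSpace ℝ (Fin d)) : ℝ :=
  ∫ x in T.patch i ∩ T.patch j, |inner ℝ (∇ (T.hat i) x) (∇ (T.hat j) x)|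

/-- The angle condition: `∫_K ∇φᵢ · ∇φⱼ ≤ 0` for each element `K` and all nodes `i ≠ j`. -/
def IsAcute : Prop :=
  ∀ K ∈ T.cells, ∀ i ∈ T.nodes, ∀ j ∈ T.nodes, i ≠ j →
    ∫ x in convexHull ℝ (K : Set (EuclideanSpace ℝ (Fin d))),
      inner ℝ (∇ (T.hat i) x) (∇ (T.hat j) x) ≤ 0

/-- The nodes `i` and `j` are the end points of an edge of the mesh. -/
def IsEdge (i j : EuclideanSpace ℝ (Fin d)) : Prop :=
  i ≠ j ∧ ∃ K ∈ T.cells, i ∈ K ∧ j ∈ K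

/-- The mesh size `h`, the maximum diameter of the elements. -/
def meshSize : ℝ :=
  ⨆ K : T.cells, Metric.diam (convexHull ℝ ((K : Finset (EuclideanSpace ℝ (Fin d))) :
    Set (EuclideanSpace ℝ (Fin d))))

/-- Shape regularity with constant `σ`: the ratio of the diameter of each element to the diameter
of its largest inscribed ball is at most `σ`. A family of meshes is regular if all its members
satisfy this with the same `σ`. -/
def ShapeRegular (σ : ℝ) : Prop :=
  ∀ K ∈ T.cells, ∃ (c : EuclideanSpace ℝ (Fin d)) (r : ℝ), 0 < r ∧
    Metric.closedBall c r ⊆ convexHull ℝ (K : Set (EuclideanSpace ℝ (Fin d))) ∧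
    Metric.diam (convexHull ℝ (K : Set (EuclideanSpace ℝ (Fin d)))) ≤ σ * (2 * r)

end SimplicialMesh

end

/-! On an element $K$ put $k_{ij}=\nabla\phi_i\cdot\nabla\phi_j$ and let $u_h,v_h$ be the Lagrange
interpolants. The angle condition makes $|k_{ij}|=-k_{ij}$ off the diagonal, while diagonal terms
carry the factor $V^i-V^i=0$. Hence $-\sum U^ic_{ij}\tilde W^{ij}(V^j-V^i)$ splits into the cell
sums $|K|\sum k_{ij}\tilde W^{ij}U^i(V^j-V^i)$ (`neg_sum_coeff_eq`). Since $\sum_j\nabla\phi_j=0$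
and $k_{ij}$ is symmetric, the cell sum with constant weight is $|K|\nabla u_h\cdot\nabla v_h$, also
equal to $-\frac12|K|\sum k_{ij}(U^i-U^j)(V^i-V^j)$ (`inner_interpGrad`).

Two errors remain on each cell. Replacing $w$ by $\tilde W^{ij}$ costs the Lipschitz constant of $w$
times the diameter; shape regularity bounds $k_{ij}(U^i-U^j)(V^i-V^j)$ by $\sigma^2|\nabla
u_h||\nabla v_h|$ (`abs_setIntegral_mul_inner_interpGrad_sub_le`). Replacing $\nabla u,\nabla v$ by
$\nabla u_h,\nabla v_h$ costs an interpolation error (`lpNormOn_interpGrad_sub_le`). The cell bounds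
are summed by Cauchy-Schwarz.

The interpolation error needs no reference element. Interpolation reproduces affine functions, so
$\nabla u_h-\nabla u(y)$ is the sum over the vertices of $\nabla\phi_i$ times the remainder at $x_i$
of the Taylor formula centred at $y$. It thus suffices that the squared remainder, integrated over
$y\in K$, is at most $4h^4\|D^2u\|_{L^2(K)}^2$. Writing the remainder as $\int_0^1
s\,D^2u(x+s(y-x))(y-x)^2\,ds$, a weighted Cauchy-Schwarz inequality and the change of variable
$y\mapsto x+s(y-x)$ leave the integrable factor $s^{5/2-d}\le s^{-1/2}$, because $d\le3$.

This is proved for mollifications and passes to almost every $x$ by Fatou's lemma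
(`ae_lintegral_taylorRem_le`). With the interior cone condition the same estimate shows that $u$ has
uniformly small oscillation near each point of $\overline\Omega$. This gives the continuous
representative, and a second use of Fatou's lemma carries the estimate to the vertices
(`exists_isContRep_of_memH2`). -/

noncomputable section

open Filter Topology Metric

/-! ### Mollification -/

section Mollify

variable {d : ℕ}

local notation "E" => EuclideanSpace ℝ (Fin d)

/-- A bump function supported in the ball of radius `1 / (n + 1)`. -/
def stdBump (d n : ℕ) : ContDiffBump (0 : EuclideanSpace ℝ (Fin d)) where
  rIn := (1 / (n + 1) : ℝ) / 2
  rOut := 1 / (n + 1)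
  rIn_pos := by positivity
  rIn_lt_rOut := half_lt_self (by positivity)

/-- The normalized bump function supported in the ball of radius `1 / (n + 1)`. -/
def stdKernel (d n : ℕ) (x : EuclideanSpace ℝ (Fin d)) : ℝ := (stdBump d n).normed volume x

theorem stdKernel_nonneg (n : ℕ) (x : E) : 0 ≤ stdKernel d n x := (stdBump d n).nonneg_normed x

theorem contDiff_stdKernel (n : ℕ) : ContDiff ℝ ∞ (stdKernel d n) := (stdBump d n).contDiff_normed

theorem hasCompactSupport_stdKernel (n : ℕ) : HasCompactSupport (stdKernel d n) :=
  (stdBump d n).hasCompactSupport_normed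

theorem tsupport_stdKernel (n : ℕ) : tsupport (stdKernel d n) = closedBall 0 (1 / (n + 1)) :=
  (stdBump d n).tsupport_normed_eq

theorem stdKernel_eq_zero {n : ℕ} {x : E} (hx : x ∉ closedBall (0 : E) (1 / (n + 1))) :
    stdKernel d n x = 0 := by
  rw [← tsupport_stdKernel] at hx
  exact image_eq_zero_of_notMem_tsupport hx

theorem measurable_stdKernel (n : ℕ) : Measurable (stdKernel d n) :=
  (contDiff_stdKernel n).continuous.measurable

theorem lintegral_stdKernel (n : ℕ) : ∫⁻ t, ENNReal.ofReal (stdKernel d n t) = 1 := by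
  have h := ofReal_integral_eq_lintegral_ofReal (μ := volume) (f := stdKernel d n)
    (stdBump d n).integrable_normed (Eventually.of_forall (stdKernel_nonneg n))
  rw [← h, show ∫ x, stdKernel d n x = 1 from (stdBump d n).integral_normed, ENNReal.ofReal_one]

/-- The mollification of `f`. -/
def mollify (n : ℕ) (f : E → ℝ) : E → ℝ :=
  MeasureTheory.convolution (stdKernel d n) f (ContinuousLinearMap.lsmul ℝ ℝ) volume

theorem mollify_apply (n : ℕ) (f : E → ℝ) (x : E) :
    mollify n f x = ∫ t, stdKernel d n t * f (x - t) := rfl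

theorem mollify_apply' (n : ℕ) (f : E → ℝ) (x : E) :
    mollify n f x = ∫ t, stdKernel d n (x - t) * f t :=
  convolution_eq_swap _

theorem ae_tendsto_mollify {f : E → ℝ} (hf : LocallyIntegrable f) :
    ∀ᵐ x, Tendsto (fun n => mollify n f x) atTop (𝓝 (f x)) := by
  -- The outer radius is exactly twice the inner one, so the kernels stay comparable to normalized
  -- indicators of balls, and Lebesgue differentiation applies.
  refine ContDiffBump.ae_convolution_tendsto_right_of_locallyIntegrable (K := 2)
    (φ := fun n => stdBump d n) ?_ ?_ hf
  · exact tendsto_one_div_add_atTop_nhds_zero_nat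
  · refine Eventually.of_forall fun n => ?_
    change (1 / (n + 1) : ℝ) ≤ 2 * ((1 / (n + 1)) / 2)
    linarith

theorem continuous_mollify (n : ℕ) {f : E → ℝ} (hf : LocallyIntegrable f) :
    Continuous (mollify n f) :=
  (hasCompactSupport_stdKernel n).continuous_convolution_left _
    (contDiff_stdKernel n).continuous hf

theorem integrable_stdKernel_mul (n : ℕ) {f : E → ℝ} (hf : LocallyIntegrable f) (x : E) :
    Integrable (fun t => stdKernel d n t * f (x - t)) :=
  (hasCompactSupport_stdKernel n).convolutionExists_left (ContinuousLinearMap.lsmul ℝ ℝ)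
    (contDiff_stdKernel n).continuous hf x

theorem mollify_sum_mul {ι : Type*} (s : Finset ι) (n : ℕ) {f : ι → E → ℝ}
    (hf : ∀ i, LocallyIntegrable (f i)) (a : ι → ℝ) (x : E) :
    ∑ i ∈ s, a i * mollify n (f i) x = mollify n (fun y => ∑ i ∈ s, a i * f i y) x := by
  simp only [mollify_apply, Finset.mul_sum]
  rw [integral_finsetSum]
  · refine Finset.sum_congr rfl fun i _ => ?_
    rw [← integral_const_mul]
    exact integral_congr_ae (Eventually.of_forall fun t => by simp only []; ring)
  · intro i _
    refine ((integrable_stdKernel_mul n (hf i) x).const_mul (a i)).congr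
      (Eventually.of_forall fun t => by simp only []; ring)

theorem hasFDerivAt_mollify (n : ℕ) {f : E → ℝ} (hf : LocallyIntegrable f) (x : E) :
    ∃ L : E →L[ℝ] ℝ, HasFDerivAt (mollify n f) L x ∧
      ∀ e, L e = ∫ t, fderiv ℝ (stdKernel d n) (x - t) e * f t := by
  have h1 : ContDiff ℝ 1 (stdKernel d n) := (contDiff_stdKernel n).of_le (by simp)
  refine ⟨_, (hasCompactSupport_stdKernel n).hasFDerivAt_convolution_left _ h1 hf x, fun e => ?_⟩
  have h2 : Continuous (fderiv ℝ (stdKernel d n)) := h1.continuous_fderiv (by simp)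
  have h3 := ((hasCompactSupport_stdKernel (d := d) n).fderiv ℝ).convolutionExists_left
    ((ContinuousLinearMap.lsmul ℝ ℝ).precompL E) h2 hf x
  rw [convolution_eq_swap]
  rw [ContinuousLinearMap.integral_apply]
  · rfl
  · have := h3.integrable_swap
    exact this

/-- The partial derivatives of a mollification are the mollifications of the weak partial
derivatives. -/
theorem fderiv_mollify_single {Ω : Set E} (hΩ : MeasurableSet Ω) {i : Fin d} {f g : E → ℝ}
    (h : HasWeakPartial Ω i f g) {n : ℕ} {x : E} (hx : closedBall x (1 / (n + 1)) ⊆ Ω) :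
    ∫ t, fderiv ℝ (stdKernel d n) (x - t) (EuclideanSpace.single i 1) * Ω.indicator f t =
      mollify n (Ω.indicator g) x := by
  -- The reflected kernel $y\mapsto\rho_n(x-y)$ is the test function. The sign from the reflection
  -- cancels the one in the definition of the weak derivative.
  have hφ : ContDiff ℝ ∞ fun y => stdKernel d n (x - y) :=
    (contDiff_stdKernel n).comp (contDiff_const.sub contDiff_id)
  have hs : tsupport (fun y => stdKernel d n (x - y)) ⊆ closedBall x (1 / (n + 1)) := by
    refine closure_minimal (fun y hy => ?_) isClosed_closedBall
    by_contra hy'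
    refine hy (stdKernel_eq_zero fun h => hy' ?_)
    simpa [dist_eq_norm, norm_sub_rev] using h
  have key := h.2.2 _ hφ (HasCompactSupport.of_support_subset_isCompact
    (isCompact_closedBall x (1 / (n + 1))) (subset_closure.trans hs)) (hs.trans hx)
  have hd : ∀ y e, fderiv ℝ (fun y => stdKernel d n (x - y)) y e =
      - fderiv ℝ (stdKernel d n) (x - y) e := by
    intro y e
    have h1 : HasFDerivAt (stdKernel d n) (fderiv ℝ (stdKernel d n) (x - y)) (x - y) :=
      ((contDiff_stdKernel n).differentiable (by simp) _).hasFDerivAt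
    have h2 := h1.comp y ((hasFDerivAt_id y).const_sub x)
    rw [show (fun y => stdKernel d n (x - y)) = stdKernel d n ∘ (fun y => x - y) from rfl,
      HasFDerivAt.fderiv h2]
    simp
  simp only [hd, mul_neg, integral_neg, neg_inj] at key
  rw [mollify_apply']
  have e1 : ∀ p : E → ℝ, ∀ q : E → ℝ, (∫ t, p t * Ω.indicator q t) = ∫ t in Ω, q t * p t := by
    intro p q
    rw [← integral_indicator hΩ]
    refine integral_congr_ae (Eventually.of_forall fun t => ?_)
    by_cases ht : t ∈ Ω <;> simp [ht, mul_comm]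
  rw [e1, e1, key]

theorem hasDerivAt_mollify_line {Ω : Set E} (hΩ : MeasurableSet Ω) {f : E → ℝ} {g : Fin d → E → ℝ}
    (h : ∀ i, HasWeakPartial Ω i f (g i)) (hf : IntegrableOn f Ω) {n : ℕ} {x e : E} {s : ℝ}
    (hx : closedBall (x + s • e) (1 / (n + 1)) ⊆ Ω) :
    HasDerivAt (fun s : ℝ => mollify n (Ω.indicator f) (x + s • e))
      (∑ i, e i * mollify n (Ω.indicator (g i)) (x + s • e)) s := by
  obtain ⟨L, hL, hL'⟩ := hasFDerivAt_mollify n (hf.integrable_indicator hΩ).locallyIntegrable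
    (x + s • e)
  have h1 : HasDerivAt (fun s : ℝ => x + s • e) e s := by
    simpa using ((hasDerivAt_id s).smul_const e).const_add x
  have h2 := hL.comp_hasDerivAt s h1
  have he : e = ∑ i, e i • EuclideanSpace.single i (1 : ℝ) := by
    ext j
    simp [Finset.sum_apply, Pi.single_apply]
  suffices h3 : L e = ∑ i, e i * mollify n (Ω.indicator (g i)) (x + s • e) from h3 ▸ h2
  refine (congrArg L he).trans ?_
  rw [map_sum]
  refine Finset.sum_congr rfl fun i _ => ?_
  rw [map_smul, smul_eq_mul, hL', fderiv_mollify_single hΩ (h i) hx]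

/-- The mollification of a nonnegative function. -/
def lmollify (n : ℕ) (P : E → ℝ≥0∞) (x : E) : ℝ≥0∞ :=
  ∫⁻ t, ENNReal.ofReal (stdKernel d n t) * P (x - t)

theorem measurable_lmollify (n : ℕ) {P : E → ℝ≥0∞} (hP : Measurable P) :
    Measurable (lmollify n P) := by
  unfold lmollify
  refine Measurable.lintegral_prod_right'
    (f := fun x : E × E => ENNReal.ofReal (stdKernel d n x.2) * P (x.1 - x.2)) ?_
  exact ((measurable_stdKernel n).comp measurable_snd).ennreal_ofReal.mul
    (hP.comp (measurable_fst.sub measurable_snd))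

theorem lintegral_lmollify (n : ℕ) {P : E → ℝ≥0∞} (hP : Measurable P) :
    ∫⁻ x, lmollify n P x = ∫⁻ x, P x := by
  unfold lmollify
  rw [lintegral_lintegral_swap]
  · have : ∀ t : E, ∫⁻ x, ENNReal.ofReal (stdKernel d n t) * P (x - t) =
        ENNReal.ofReal (stdKernel d n t) * ∫⁻ x, P x := fun t => by
      rw [lintegral_const_mul _ (f := fun x => P (x - t)) (hP.comp (measurable_id.sub_const t)),
        lintegral_sub_right_eq_self P t]
    simp only [this]
    rw [lintegral_mul_const _ (measurable_stdKernel n).ennreal_ofReal, lintegral_stdKernel, one_mul]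
  · exact (((measurable_stdKernel n).comp measurable_snd).ennreal_ofReal.mul
      (hP.comp (measurable_fst.sub measurable_snd))).aemeasurable

/-- The Cauchy-Schwarz inequality with a weight. -/
theorem lintegral_mul_sq_le {α : Type*} [MeasurableSpace α] (μ : Measure α) {f g : α → ℝ≥0∞}
    (hf : AEMeasurable f μ) (hg : AEMeasurable g μ) :
    (∫⁻ a, f a * g a ∂μ) ^ 2 ≤ (∫⁻ a, f a ^ 2 ∂μ) * ∫⁻ a, g a ^ 2 ∂μ := by
  have h := ENNReal.lintegral_mul_le_Lp_mul_Lq μ Real.HolderConjugate.two_two hf hg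
  simp only [Pi.mul_apply, ENNReal.rpow_ofNat] at h
  calc _ ≤ ((∫⁻ a, f a ^ 2 ∂μ) ^ (1 / 2 : ℝ) * (∫⁻ a, g a ^ 2 ∂μ) ^ (1 / 2 : ℝ)) ^ 2 := by
        gcongr
    _ = _ := by
        rw [mul_pow, ← ENNReal.rpow_natCast, ← ENNReal.rpow_natCast, ← ENNReal.rpow_mul,
          ← ENNReal.rpow_mul]
        norm_num

/-- Jensen's inequality: Cauchy-Schwarz for $\sqrt{\rho_n}\cdot\sqrt{\rho_n}P$, the kernel having
mass one. -/
theorem lmollify_sq_le (n : ℕ) {P : E → ℝ≥0∞} (hP : Measurable P) (x : E) :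
    lmollify n P x ^ 2 ≤ lmollify n (fun y => P y ^ 2) x := by
  have hm : Measurable fun t => ENNReal.ofReal (Real.sqrt (stdKernel d n t)) :=
    (measurable_stdKernel n).sqrt.ennreal_ofReal
  have hs : ∀ t, ENNReal.ofReal (Real.sqrt (stdKernel d n t)) ^ 2 =
      ENNReal.ofReal (stdKernel d n t) := fun t => by
    rw [← ENNReal.ofReal_pow (Real.sqrt_nonneg _), Real.sq_sqrt (stdKernel_nonneg n t)]
  have h := lintegral_mul_sq_le volume hm.aemeasurable
    (hm.mul (hP.comp (measurable_const.sub measurable_id : Measurable fun t => x - t))).aemeasurable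
  simp only [Pi.mul_apply, mul_pow, hs, lintegral_stdKernel, one_mul, ← mul_assoc, ← pow_two] at h
  exact h

/-- A mollification at `x` only sees the function near `x`. -/
theorem enorm_mollify_le {n : ℕ} {U : Set E} (hU : MeasurableSet U) {f : E → ℝ} {P : E → ℝ≥0∞}
    (hf : ∀ᵐ y ∂volume.restrict U, ‖f y‖ₑ ≤ P y) {x : E} (hx : closedBall x (1 / (n + 1)) ⊆ U) :
    ‖mollify n f x‖ₑ ≤ lmollify n (U.indicator P) x := by
  rw [mollify_apply, lmollify]
  refine (enorm_integral_le_lintegral_enorm _).trans (lintegral_mono_ae ?_)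
  have h1 : ∀ᵐ t : E, x - t ∈ U → ‖f (x - t)‖ₑ ≤ P (x - t) :=
    (Measure.measurePreserving_sub_left volume x).quasiMeasurePreserving.ae
      ((ae_restrict_iff' hU).1 hf)
  filter_upwards [h1] with t ht
  rw [enorm_mul, Real.enorm_of_nonneg (stdKernel_nonneg n t)]
  by_cases h0 : t ∈ closedBall (0 : E) (1 / (n + 1))
  · have : x - t ∈ U := hx (by simpa [dist_eq_norm] using h0)
    gcongr
    simpa [this] using ht this
  · simp [stdKernel_eq_zero h0]

end Mollify

/-! ### Taylor's formula for mollifications and the weighted inequalities for its remainder -/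

section Taylor

variable {d : ℕ}

local notation "E" => EuclideanSpace ℝ (Fin d)

/-- Integrate the derivative of $sf'-f$. The expansion is centred at $s=1$, so the weight is $s$ and
not $1-s$: it vanishes at the evaluation point $s=0$, where the homothety used later degenerates. -/
theorem sub_add_deriv_eq_integral {f f' f'' : ℝ → ℝ} (hf : ∀ s ∈ Icc (0 : ℝ) 1, HasDerivAt f (f' s) s)
    (hf' : ∀ s ∈ Icc (0 : ℝ) 1, HasDerivAt f' (f'' s) s) (hc : Continuous f'') :
    f 0 - f 1 + f' 1 = ∫ s in (0 : ℝ)..1, s * f'' s := by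
  have h : ∀ s ∈ uIcc (0 : ℝ) 1, HasDerivAt (fun s => s * f' s - f s) (s * f'' s) s := by
    intro s hs
    rw [uIcc_of_le zero_le_one] at hs
    have : HasDerivAt (fun s => s * f' s - f s) (1 * f' s + s * f'' s - f' s) s :=
      ((hasDerivAt_id' s).mul (hf' s hs)).sub (hf s hs)
    simpa using this
  rw [intervalIntegral.integral_eq_sub_of_hasDerivAt h
    (continuous_id.mul hc).continuousOn.intervalIntegrable]
  ring

theorem enorm_intervalIntegral_mul_le (g : ℝ → ℝ) :
    ‖∫ s in (0 : ℝ)..1, s * g s‖ₑ ≤ ∫⁻ s in Ioc (0 : ℝ) 1, ENNReal.ofReal s * ‖g s‖ₑ := by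
  rw [intervalIntegral.integral_of_le zero_le_one]
  refine (enorm_integral_le_lintegral_enorm _).trans (setLIntegral_mono' measurableSet_Ioc ?_)
  intro s hs
  rw [enorm_mul, Real.enorm_of_nonneg hs.1.le]

theorem abs_sum_sum_mul_le (e : E) (H : Fin d → Fin d → ℝ) :
    |∑ i, e i * ∑ j, e j * H i j| ≤ ‖e‖ ^ 2 * Real.sqrt (∑ i, ∑ j, H i j ^ 2) := by
  have h1 : ∑ i, e i * ∑ j, e j * H i j = ∑ p : Fin d × Fin d, (e p.1 * e p.2) * H p.1 p.2 := by
    rw [Fintype.sum_prod_type]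
    exact Finset.sum_congr rfl fun i _ => by
      rw [Finset.mul_sum]; exact Finset.sum_congr rfl fun j _ => by ring
  have h2 := Finset.sum_mul_sq_le_sq_mul_sq Finset.univ
    (fun p : Fin d × Fin d => e p.1 * e p.2) (fun p => H p.1 p.2)
  have h3 : ∑ p : Fin d × Fin d, (e p.1 * e p.2) ^ 2 = (‖e‖ ^ 2) ^ 2 := by
    rw [EuclideanSpace.norm_sq_eq, Fintype.sum_prod_type, pow_two, Finset.sum_mul_sum]
    refine Finset.sum_congr rfl fun i _ => Finset.sum_congr rfl fun j _ => ?_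
    simp only [Real.norm_eq_abs, sq_abs]
    ring
  rw [h1]
  refine abs_le_of_sq_le_sq ?_ (by positivity)
  rw [mul_pow, Real.sq_sqrt (by positivity), ← h3]
  simpa [Fintype.sum_prod_type] using h2

/-- The Frobenius norm of the weak Hessian. -/
def hessNorm (Ω : Set E) (u : E → ℝ) (x : E) : ℝ :=
  Real.sqrt (∑ i, ∑ j, weakPartial Ω j (weakPartial Ω i u) x ^ 2)

theorem integrableOn_of_memLp_two {Ω : Set E} (hb : Bornology.IsBounded Ω) {f : E → ℝ} {p : ℝ≥0∞}
    (hp : 1 ≤ p) (hf : MemLp f p (volume.restrict Ω)) : IntegrableOn f Ω := by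
  have : IsFiniteMeasure (volume.restrict Ω) := ⟨by simpa using hb.measure_lt_top⟩
  exact hf.integrable hp

variable {Ω : Set (EuclideanSpace ℝ (Fin d))} {u : EuclideanSpace ℝ (Fin d) → ℝ}

theorem enorm_mollify_hessian_le {n : ℕ} {U : Set E} (hU : MeasurableSet U)
    {H : Fin d → Fin d → E → ℝ} (hH : ∀ i j, LocallyIntegrable (H i j)) {Q : E → ℝ≥0∞}
    (hQ : ∀ᵐ z ∂volume.restrict U, ‖Real.sqrt (∑ i, ∑ j, H i j z ^ 2)‖ₑ ≤ Q z) {z : E}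
    (hz : closedBall z (1 / (n + 1)) ⊆ U) (e : E) :
    ‖∑ i, e i * ∑ j, e j * mollify n (H i j) z‖ₑ ≤
      ENNReal.ofReal (‖e‖ ^ 2) * lmollify n (U.indicator Q) z := by
  have hcomb : ∑ i, e i * ∑ j, e j * mollify n (H i j) z =
      mollify n (fun z => ∑ i, e i * ∑ j, e j * H i j z) z := by
    have hl : ∀ i, LocallyIntegrable fun z => ∑ j, e j * H i j z := fun i =>
      locallyIntegrable_finsetSum _ fun j _ => (hH i j).smul (e j)
    rw [← mollify_sum_mul _ _ hl]
    exact Finset.sum_congr rfl fun i _ => by rw [mollify_sum_mul _ _ (hH i)]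
  have hle := enorm_mollify_le (n := n) hU (x := z)
    (f := fun z => ∑ i, e i * ∑ j, e j * H i j z)
    (P := fun z => ENNReal.ofReal (‖e‖ ^ 2) * Q z) (by
      filter_upwards [hQ] with z hz
      refine le_trans ?_ (mul_le_mul_right hz _)
      rw [Real.enorm_eq_ofReal_abs, Real.enorm_eq_ofReal_abs, ← ENNReal.ofReal_mul (by positivity),
        abs_of_nonneg (Real.sqrt_nonneg _)]
      exact ENNReal.ofReal_le_ofReal (abs_sum_sum_mul_le e _)) hz
  rw [hcomb]
  refine hle.trans (le_of_eq ?_)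
  simp only [lmollify]
  rw [← lintegral_const_mul' _ _ ENNReal.ofReal_ne_top]
  refine lintegral_congr fun t => ?_
  by_cases ht : z - t ∈ U <;> simp [ht, mul_left_comm]

/-- Taylor's formula for a mollified `H²` function. -/
theorem enorm_taylor_mollify_le (hΩ : IsOpen Ω) (hb : Bornology.IsBounded Ω) (hu : MemH2 Ω u)
    {U : Set E} (hU : MeasurableSet U) (hUΩ : U ⊆ Ω) {Q : E → ℝ≥0∞}
    (hQ : ∀ᵐ x ∂volume.restrict Ω, ‖hessNorm Ω u x‖ₑ ≤ Q x) {n : ℕ} {x y : E}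
    (hxy : ∀ s ∈ Icc (0 : ℝ) 1, closedBall (x + s • (y - x)) (1 / (n + 1)) ⊆ U) :
    ‖mollify n (Ω.indicator u) x - mollify n (Ω.indicator u) y -
        ∑ i, mollify n (Ω.indicator (weakPartial Ω i u)) y * (x i - y i)‖ₑ ≤
      ENNReal.ofReal (‖y - x‖ ^ 2) *
        ∫⁻ s in Ioc (0 : ℝ) 1, ENNReal.ofReal s * lmollify n (U.indicator Q) (x + s • (y - x)) := by
  have hm := hΩ.measurableSet
  have i0 := integrableOn_of_memLp_two hb one_le_two hu.1
  have i1 := fun i => integrableOn_of_memLp_two hb one_le_two (hu.2.1 i).2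
  have i2 := fun i j => integrableOn_of_memLp_two hb one_le_two (hu.2.2 i j).2
  have l2 := fun i j => ((i2 i j).integrable_indicator hm).locallyIntegrable
  obtain ⟨e, he⟩ : ∃ e, e = y - x := ⟨_, rfl⟩
  rw [← he] at hxy ⊢
  have hd1 : ∀ s ∈ Icc (0 : ℝ) 1, HasDerivAt (fun s : ℝ => mollify n (Ω.indicator u) (x + s • e))
      (∑ i, e i * mollify n (Ω.indicator (weakPartial Ω i u)) (x + s • e)) s := fun s hs =>
    hasDerivAt_mollify_line (g := fun i => weakPartial Ω i u) hm (fun i => (hu.2.1 i).1) i0 ((hxy s hs).trans hUΩ)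
  have hd2 : ∀ s ∈ Icc (0 : ℝ) 1, HasDerivAt
      (fun s : ℝ => ∑ i, e i * mollify n (Ω.indicator (weakPartial Ω i u)) (x + s • e))
      (∑ i, e i * ∑ j, e j *
        mollify n (Ω.indicator (weakPartial Ω j (weakPartial Ω i u))) (x + s • e)) s := fun s hs =>
    HasDerivAt.fun_sum fun i _ => HasDerivAt.const_mul (e i) (hasDerivAt_mollify_line
      (g := fun j => weakPartial Ω j (weakPartial Ω i u)) hm (fun j => (hu.2.2 i j).1) (i1 i) ((hxy s hs).trans hUΩ))
  have hc : Continuous fun s : ℝ => ∑ i, e i * ∑ j, e j *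
      mollify n (Ω.indicator (weakPartial Ω j (weakPartial Ω i u))) (x + s • e) := by
    refine continuous_finsetSum _ fun i _ => continuous_const.mul
      (continuous_finsetSum _ fun j _ => continuous_const.mul ?_)
    exact (continuous_mollify n (l2 i j)).comp (by fun_prop)
  have hT := sub_add_deriv_eq_integral hd1 hd2 hc
  have h1 : x + (1 : ℝ) • e = y := by simp [he]
  have h0 : x + (0 : ℝ) • e = x := by simp
  rw [h0, h1] at hT
  have hL : mollify n (Ω.indicator u) x - mollify n (Ω.indicator u) y -
        ∑ i, mollify n (Ω.indicator (weakPartial Ω i u)) y * (x i - y i) =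
        ∫ s in (0 : ℝ)..1, s * (∑ i, e i * ∑ j, e j *
        mollify n (Ω.indicator (weakPartial Ω j (weakPartial Ω i u))) (x + s • e)) := by
    rw [← hT, sub_eq_add_neg _ (∑ i, _), ← Finset.sum_neg_distrib]
    congr 1
    refine Finset.sum_congr rfl fun i _ => ?_
    simp only [he, PiLp.sub_apply]
    ring
  rw [hL]
  refine (enorm_intervalIntegral_mul_le _).trans ?_
  rw [← lintegral_const_mul' _ _ ENNReal.ofReal_ne_top]
  refine setLIntegral_mono' measurableSet_Ioc fun s hs => ?_
  rw [mul_left_comm]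
  gcongr
  refine enorm_mollify_hessian_le hU l2 ?_ (hxy s ⟨hs.1.le, hs.2⟩) e
  filter_upwards [ae_mono (Measure.restrict_mono hUΩ le_rfl) hQ, ae_restrict_mem hU] with z hz hzU
  have hzΩ := hUΩ hzU
  simpa only [indicator_of_mem hzΩ, hessNorm] using hz

theorem lintegral_rpow_neg_half :
    ∫⁻ s in Ioc (0 : ℝ) 1, ENNReal.ofReal (s ^ (-1 / 2 : ℝ)) = 2 := by
  have hi : IntervalIntegrable (fun s : ℝ => s ^ (-1 / 2 : ℝ)) volume 0 1 :=
    intervalIntegral.intervalIntegrable_rpow' (by norm_num)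
  rw [← ofReal_integral_eq_lintegral_ofReal
    ((intervalIntegrable_iff_integrableOn_Ioc_of_le zero_le_one).1 hi)
    ((ae_restrict_iff' measurableSet_Ioc).2
      (Eventually.of_forall fun s hs => Real.rpow_nonneg hs.1.le _)),
    ← intervalIntegral.integral_of_le zero_le_one, integral_rpow (by norm_num)]
  norm_num

/-- Cauchy-Schwarz for $s=s^{-1/4}\cdot s^{5/4}$. The first factor squares to $s^{-1/2}$, of
integral $2$; the exponent $5/2$ left on $P^2$ is large enough to absorb the Jacobian $s^{-d}$ for
$d\le3$. -/
theorem lintegral_id_mul_sq_le {P : ℝ → ℝ≥0∞} (hP : Measurable P) :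
    (∫⁻ s in Ioc (0 : ℝ) 1, ENNReal.ofReal s * P s) ^ 2 ≤
      2 * ∫⁻ s in Ioc (0 : ℝ) 1, ENNReal.ofReal (s ^ (5 / 2 : ℝ)) * P s ^ 2 := by
  have h := lintegral_mul_sq_le (volume.restrict (Ioc (0 : ℝ) 1))
    (f := fun s => ENNReal.ofReal (s ^ (-1 / 4 : ℝ)))
    (g := fun s => ENNReal.ofReal (s ^ (5 / 4 : ℝ)) * P s)
    (by fun_prop) (by fun_prop)
  have e1 : ∫⁻ s in Ioc (0 : ℝ) 1, ENNReal.ofReal (s ^ (-1 / 4 : ℝ)) *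
      (ENNReal.ofReal (s ^ (5 / 4 : ℝ)) * P s) = ∫⁻ s in Ioc (0 : ℝ) 1, ENNReal.ofReal s * P s := by
    refine setLIntegral_congr_fun measurableSet_Ioc fun s hs => ?_
    rw [← mul_assoc, ← ENNReal.ofReal_mul (Real.rpow_nonneg hs.1.le _), ← Real.rpow_add hs.1]
    norm_num
  have e2 : ∫⁻ s in Ioc (0 : ℝ) 1, ENNReal.ofReal (s ^ (-1 / 4 : ℝ)) ^ 2 = 2 := by
    rw [← lintegral_rpow_neg_half]
    refine setLIntegral_congr_fun measurableSet_Ioc fun s hs => ?_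
    rw [← ENNReal.ofReal_pow (Real.rpow_nonneg hs.1.le _), ← Real.rpow_mul_natCast hs.1.le]
    norm_num
  have e3 : ∫⁻ s in Ioc (0 : ℝ) 1, (ENNReal.ofReal (s ^ (5 / 4 : ℝ)) * P s) ^ 2 =
      ∫⁻ s in Ioc (0 : ℝ) 1, ENNReal.ofReal (s ^ (5 / 2 : ℝ)) * P s ^ 2 := by
    refine setLIntegral_congr_fun measurableSet_Ioc fun s hs => ?_
    rw [mul_pow, ← ENNReal.ofReal_pow (Real.rpow_nonneg hs.1.le _), ← Real.rpow_mul_natCast hs.1.le]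
    norm_num
  rwa [e1, e2, e3] at h

theorem lintegral_comp_homothety (P : E → ℝ≥0∞) (hP : Measurable P) (x : E) {s : ℝ} (hs : 0 < s) :
    ∫⁻ y, P (x + s • (y - x)) = ENNReal.ofReal ((s ^ d)⁻¹) * ∫⁻ y, P y := by
  have h1 : ∀ y, x + s • (y - x) = s • y + (x - s • x) := fun y => by
    rw [smul_sub]; abel
  simp only [h1]
  have h2 := lintegral_map (μ := volume) (f := fun z : E => P (z + (x - s • x)))
    (hP.comp (measurable_id.add_const _)) (measurable_const_smul s : Measurable fun y : E => s • y)
  rw [← h2, Measure.map_addHaar_smul _ hs.ne', lintegral_smul_measure,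
    lintegral_add_right_eq_self P]
  simp [abs_of_pos hs]

/-- After exchanging the integrals, the homothety of centre $x$ and ratio $s$ contributes $s^{-d}$,
and $s^{5/2-d}\le s^{-1/2}$ on $(0,1]$ exactly because $d\le3$. -/
theorem lintegral_weighted_le (hd : d ≤ 3) {P : E → ℝ≥0∞} (hP : Measurable P) (x : E) :
    ∫⁻ y, ∫⁻ s in Ioc (0 : ℝ) 1, ENNReal.ofReal (s ^ (5 / 2 : ℝ)) * P (x + s • (y - x)) ≤
      2 * ∫⁻ y, P y := by
  have h2 : 2 * ∫⁻ y, P y = ∫⁻ s in Ioc (0 : ℝ) 1, ENNReal.ofReal (s ^ (-1 / 2 : ℝ)) * ∫⁻ y, P y := by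
    rw [lintegral_mul_const _ (by fun_prop), lintegral_rpow_neg_half]
  rw [lintegral_lintegral_swap (by fun_prop), h2]
  refine setLIntegral_mono' measurableSet_Ioc fun s hs => ?_
  rw [lintegral_const_mul _ (by fun_prop), lintegral_comp_homothety P hP x hs.1, ← mul_assoc,
    ← ENNReal.ofReal_mul (Real.rpow_nonneg hs.1.le _)]
  gcongr
  rw [← Real.rpow_natCast, ← Real.rpow_neg hs.1.le, ← Real.rpow_add hs.1]
  refine Real.rpow_le_rpow_of_exponent_ge hs.1 hs.2 ?_
  have : (d : ℝ) ≤ 3 := by exact_mod_cast hd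
  linarith

end Taylor

/-! ### Mean Taylor estimate and Lipschitz estimate at almost every point -/

section Estimates

variable {d : ℕ} {Ω : Set (EuclideanSpace ℝ (Fin d))} {u w : EuclideanSpace ℝ (Fin d) → ℝ}

local notation "E" => EuclideanSpace ℝ (Fin d)

theorem inner_weakGrad (y e : E) :
    inner ℝ (weakGrad Ω u y) e = ∑ i, weakPartial Ω i u y * e i := by
  simp [weakGrad, PiLp.inner_apply, mul_comm]

theorem memLp_weakGrad {p : ℝ≥0∞} {μ : Measure E} (h : ∀ i, MemLp (weakPartial Ω i u) p μ) :
    MemLp (weakGrad Ω u) p μ :=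
  MemLp.of_eval_piLp h

theorem eventually_segment_closedBall_subset {x y : E} {U : Set E} (hU : IsOpen U)
    (h : segment ℝ x y ⊆ U) : ∀ᶠ n : ℕ in atTop, ∀ s ∈ Icc (0 : ℝ) 1,
      closedBall (x + s • (y - x)) (1 / (n + 1)) ⊆ U := by
  have hc : IsCompact (segment ℝ x y) := by
    rw [segment_eq_image']
    exact isCompact_Icc.image (by fun_prop)
  obtain ⟨δ, hδ, hδU⟩ := hc.exists_cthickening_subset_open hU h
  filter_upwards [(tendsto_one_div_add_atTop_nhds_zero_nat (𝕜 := ℝ)).eventually_le_const hδ]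
    with n hn s hs
  have hmem : x + s • (y - x) ∈ segment ℝ x y := by
    rw [segment_eq_image']
    exact ⟨s, hs, rfl⟩
  exact (closedBall_subset_closedBall hn).trans ((closedBall_subset_cthickening hmem δ).trans hδU)

theorem aestronglyMeasurable_hessNorm (hu : MemH2 Ω u) :
    AEStronglyMeasurable (hessNorm Ω u) (volume.restrict Ω) := by
  have h : ∀ i j, AEMeasurable (weakPartial Ω j (weakPartial Ω i u)) (volume.restrict Ω) :=
    fun i j => (hu.2.2 i j).2.1.aemeasurable
  unfold hessNorm
  exact (AEMeasurable.sqrt (Finset.aemeasurable_fun_sum _ fun i _ =>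
    Finset.aemeasurable_fun_sum _ fun j _ => (h i j).pow_const 2)).aestronglyMeasurable

/-- The remainder of Taylor's formula of order one, centred at `y` and evaluated at `x`. -/
def taylorRem (Ω : Set (EuclideanSpace ℝ (Fin d))) (u : EuclideanSpace ℝ (Fin d) → ℝ)
    (c : ℝ) (x y : EuclideanSpace ℝ (Fin d)) : ℝ :=
  c - u y - inner ℝ (weakGrad Ω u y) (x - y)

/-- Pass to the limit in the estimate for mollifications at the points where they converge. The
exceptional null set precedes the quantifiers on $U$, $B$ and $h$, so a single set of good points
serves both the cones and all the elements. The constant $4$ is the product of the factors $2$ of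
`lintegral_id_mul_sq_le` and `lintegral_weighted_le`. -/
theorem ae_lintegral_taylorRem_le (hd : d ≤ 3) (hΩ : IsOpen Ω) (hb : Bornology.IsBounded Ω)
    (hu : MemH2 Ω u) : ∀ᵐ x ∂volume.restrict Ω, ∀ (U B : Set E) (h : ℝ), IsOpen U → U ⊆ Ω →
      MeasurableSet B → (∀ y ∈ B, segment ℝ x y ⊆ U) → (∀ y ∈ B, ‖y - x‖ ≤ h) →
      ∫⁻ y in B, ‖taylorRem Ω u (u x) x y‖ₑ ^ 2 ≤
        ENNReal.ofReal (4 * h ^ 4) * ∫⁻ z in U, ‖hessNorm Ω u z‖ₑ ^ 2 := by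
  have hm := hΩ.measurableSet
  have l0 := ((integrableOn_of_memLp_two hb one_le_two hu.1).integrable_indicator
    hm).locallyIntegrable
  have l1 := fun i => ((integrableOn_of_memLp_two hb one_le_two
    (hu.2.1 i).2).integrable_indicator hm).locallyIntegrable
  have hQm := (aestronglyMeasurable_hessNorm hu).enorm
  -- The Hessian norm is only almost everywhere measurable; a measurable modification allows
  -- Tonelli's theorem and the composition with homotheties.
  set q : E → ℝ≥0∞ := hQm.mk _ with hq
  have hqm : Measurable q := hQm.measurable_mk
  have hqe : ∀ᵐ x ∂volume.restrict Ω, ‖hessNorm Ω u x‖ₑ = q x := hQm.ae_eq_mk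
  have t0 := ae_tendsto_mollify l0
  have t1 : ∀ᵐ x, ∀ i, Tendsto (fun n => mollify n (Ω.indicator (weakPartial Ω i u)) x) atTop
      (𝓝 (Ω.indicator (weakPartial Ω i u) x)) := ae_all_iff.2 fun i => ae_tendsto_mollify (l1 i)
  filter_upwards [ae_restrict_of_ae t0, ae_restrict_mem hm] with x hx hxΩ U B h hU hUΩ hB hseg hh
  rw [indicator_of_mem hxΩ] at hx
  have hPm : Measurable fun z => U.indicator q z ^ 2 := (hqm.indicator hU.measurableSet).pow_const 2
  set F : ℕ → E → ℝ≥0∞ := fun n y => ENNReal.ofReal (h ^ 4) *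
    (2 * ∫⁻ s in Ioc (0 : ℝ) 1, ENNReal.ofReal (s ^ (5 / 2 : ℝ)) *
      lmollify n (fun z => U.indicator q z ^ 2) (x + s • (y - x))) with hF
  have hFm : ∀ n, Measurable (F n) := by
    intro n
    have := measurable_lmollify n hPm
    refine Measurable.const_mul (Measurable.const_mul ?_ _) _
    refine Measurable.lintegral_prod_right' (f := fun p : E × ℝ => ENNReal.ofReal (p.2 ^ (5 / 2 : ℝ)) *
      lmollify n (fun z => U.indicator q z ^ 2) (x + p.2 • (p.1 - x))) ?_
    fun_prop
  have hFi : ∀ n, ∫⁻ y in B, F n y ≤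
      ENNReal.ofReal (4 * h ^ 4) * ∫⁻ z in U, ‖hessNorm Ω u z‖ₑ ^ 2 := by
    intro n
    have hl := measurable_lmollify n hPm
    have e1 : ∫⁻ z in U, ‖hessNorm Ω u z‖ₑ ^ 2 = ∫⁻ z, U.indicator q z ^ 2 := by
      rw [← lintegral_indicator hU.measurableSet]
      have := (ae_restrict_iff' hm).1 hqe
      refine lintegral_congr_ae ?_
      filter_upwards [this] with z hz
      by_cases hzU : z ∈ U
      · simp [hzU, hz (hUΩ hzU)]
      · simp [hzU]
    rw [e1]
    refine (setLIntegral_le_lintegral _ _).trans ?_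
    simp only [hF]
    have hme : Measurable fun y => ∫⁻ s in Ioc (0 : ℝ) 1, ENNReal.ofReal (s ^ (5 / 2 : ℝ)) *
      lmollify n (fun z => U.indicator q z ^ 2) (x + s • (y - x)) := by
      refine Measurable.lintegral_prod_right' (f := fun p : E × ℝ =>
        ENNReal.ofReal (p.2 ^ (5 / 2 : ℝ)) *
        lmollify n (fun z => U.indicator q z ^ 2) (x + p.2 • (p.1 - x))) ?_
      fun_prop
    rw [lintegral_const_mul _ (hme.const_mul _), lintegral_const_mul _ hme,
      ENNReal.ofReal_mul (by norm_num), mul_comm (ENNReal.ofReal 4), mul_assoc]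
    refine mul_le_mul_right ?_ _
    refine (mul_le_mul_right (lintegral_weighted_le hd hl x) _).trans (le_of_eq ?_)
    rw [lintegral_lmollify n hPm, ← mul_assoc]
    norm_num
  have key : ∀ᵐ y ∂volume.restrict B, ‖taylorRem Ω u (u x) x y‖ₑ ^ 2 ≤
      liminf (fun n => F n y) atTop := by
    filter_upwards [ae_restrict_of_ae t0, ae_restrict_of_ae t1, ae_restrict_mem hB] with y hy0 hy1 hyB
    have hyΩ : y ∈ Ω := hUΩ (hseg y hyB (right_mem_segment ℝ x y))
    rw [indicator_of_mem hyΩ] at hy0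
    simp only [indicator_of_mem hyΩ] at hy1
    have hT : Tendsto (fun n => ‖mollify n (Ω.indicator u) x - mollify n (Ω.indicator u) y -
        ∑ i, mollify n (Ω.indicator (weakPartial Ω i u)) y * (x i - y i)‖ₑ ^ 2) atTop
        (𝓝 (‖taylorRem Ω u (u x) x y‖ₑ ^ 2)) := by
      have e : taylorRem Ω u (u x) x y = u x - u y - ∑ i, weakPartial Ω i u y * (x i - y i) := by
        rw [taylorRem, inner_weakGrad]
        rfl
      rw [e]
      have := (hx.sub hy0).sub (tendsto_finsetSum Finset.univ fun i _ =>
        (hy1 i).mul_const (x i - y i))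
      exact ((ENNReal.continuous_pow 2).tendsto _).comp ((continuous_enorm.tendsto _).comp this)
    rw [← hT.liminf_eq]
    refine liminf_le_liminf ?_
    filter_upwards [eventually_segment_closedBall_subset hU (hseg y hyB)] with n hn
    have h1 := enorm_taylor_mollify_le hΩ hb hu hU.measurableSet hUΩ
      (hqe.mono fun _ h => h.le) hn
    have h2 := lintegral_id_mul_sq_le (P := fun s => lmollify n (U.indicator q) (x + s • (y - x)))
      ((measurable_lmollify n (hqm.indicator hU.measurableSet)).comp (by fun_prop))
    calc _ ≤ (ENNReal.ofReal (‖y - x‖ ^ 2) * ∫⁻ s in Ioc (0 : ℝ) 1, ENNReal.ofReal s *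
          lmollify n (U.indicator q) (x + s • (y - x))) ^ 2 := by gcongr
      _ = ENNReal.ofReal (‖y - x‖ ^ 4) * (∫⁻ s in Ioc (0 : ℝ) 1, ENNReal.ofReal s *
          lmollify n (U.indicator q) (x + s • (y - x))) ^ 2 := by
        rw [mul_pow, ← ENNReal.ofReal_pow (by positivity), ← pow_mul]
      _ ≤ _ := by
        simp only [hF]
        gcongr
        · exact hh y hyB
        · refine h2.trans (mul_le_mul_right (lintegral_mono fun s => ?_) _)
          exact mul_le_mul_right (lmollify_sq_le n (hqm.indicator hU.measurableSet) _) _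
  -- Fatou's lemma; the bound `hFi` is uniform in $n$ because mollification preserves the integral.
  refine (lintegral_mono_ae key).trans ((lintegral_liminf_le hFm).trans ?_)
  exact (liminf_le_liminf (Eventually.of_forall hFi)).trans (liminf_const _).le

/-- The mean value inequality along the segment holds for mollifications, whose directional
derivatives are averages of $\nabla w\cdot(y-x)$; it survives at the points where they converge to
$w$. The segment must lie in $\Omega$, which is why the estimate is later used on convex subsets. -/
theorem exists_lipschitz_set (hΩ : IsOpen Ω) (hb : Bornology.IsBounded Ω) (hw : MemW1Inf Ω w) :
    ∃ S ⊆ Ω, (∀ᵐ x ∂volume.restrict Ω, x ∈ S) ∧ ∀ x ∈ S, ∀ y ∈ S, segment ℝ x y ⊆ Ω →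
      |w x - w y| ≤ lpNormOn Ω ∞ (weakGrad Ω w) * ‖x - y‖ := by
  have hm := hΩ.measurableSet
  have i0 := integrableOn_of_memLp_two hb le_top hw.1
  have l1 := fun i => ((integrableOn_of_memLp_two hb le_top
    (hw.2 i).2).integrable_indicator hm).locallyIntegrable
  have t0 := ae_tendsto_mollify (i0.integrable_indicator hm).locallyIntegrable
  refine ⟨{x ∈ Ω | Tendsto (fun n => mollify n (Ω.indicator w) x) atTop (𝓝 (w x))},
    fun x hx => hx.1, ?_, ?_⟩
  · filter_upwards [ae_restrict_of_ae t0, ae_restrict_mem hm] with x hx hxΩ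
    exact ⟨hxΩ, by simpa [hxΩ] using hx⟩
  rintro x ⟨-, hx⟩ y ⟨-, hy⟩ hseg
  set M := lpNormOn Ω ∞ (weakGrad Ω w) with hM
  have hM0 : 0 ≤ M := ENNReal.toReal_nonneg
  have hgrad : ∀ᵐ z ∂volume.restrict Ω, ‖weakGrad Ω w z‖ ≤ M := by
    have hfin := (memLp_weakGrad fun i => (hw.2 i).2 : MemLp (weakGrad Ω w) ∞ (volume.restrict Ω)).2
    rw [eLpNorm_exponent_top] at hfin
    filter_upwards [ae_le_eLpNormEssSup (f := weakGrad Ω w) (μ := volume.restrict Ω)] with z hz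
    rw [hM, lpNormOn, eLpNorm_exponent_top, ← toReal_enorm]
    exact ENNReal.toReal_mono hfin.ne hz
  refine le_of_tendsto ((hx.sub hy).abs) ?_
  filter_upwards [eventually_segment_closedBall_subset hΩ hseg] with n hn
  have hmv := norm_image_sub_le_of_norm_deriv_le_segment_01' (C := M * ‖x - y‖)
    (f := fun s : ℝ => mollify n (Ω.indicator w) (x + s • (y - x)))
    (f' := fun s => ∑ i, (y - x) i * mollify n (Ω.indicator (weakPartial Ω i w)) (x + s • (y - x)))
    (fun s hs => (hasDerivAt_mollify_line (g := fun i => weakPartial Ω i w) hm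
      (fun i => (hw.2 i).1) i0 (hn s hs)).hasDerivWithinAt) (fun s hs => by
      rw [mollify_sum_mul _ _ l1]
      have hle := enorm_mollify_le (n := n) hm (x := x + s • (y - x))
        (f := fun z => ∑ i, (y - x) i * Ω.indicator (weakPartial Ω i w) z)
        (P := fun _ => ENNReal.ofReal (M * ‖x - y‖)) (by
          filter_upwards [hgrad, ae_restrict_mem hm] with z hz hzΩ
          simp only [indicator_of_mem hzΩ]
          rw [Real.enorm_eq_ofReal_abs]
          refine ENNReal.ofReal_le_ofReal ?_
          have := abs_real_inner_le_norm (weakGrad Ω w z) (y - x)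
          rw [inner_weakGrad] at this
          simp only [mul_comm] at this ⊢
          refine this.trans ?_
          rw [norm_sub_rev y x]
          gcongr) (hn s ⟨hs.1, hs.2.le⟩)
      have hle2 : lmollify n (Ω.indicator fun _ => ENNReal.ofReal (M * ‖x - y‖)) (x + s • (y - x)) ≤
          ENNReal.ofReal (M * ‖x - y‖) := by
        rw [lmollify]
        calc _ ≤ ∫⁻ t, ENNReal.ofReal (stdKernel d n t) * ENNReal.ofReal (M * ‖x - y‖) :=
              lintegral_mono fun t => by
                by_cases ht : x + s • (y - x) - t ∈ Ω <;> simp [ht]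
          _ = _ := by
            rw [lintegral_mul_const _ (measurable_stdKernel n).ennreal_ofReal,
              lintegral_stdKernel, one_mul]
      have := hle.trans hle2
      rw [Real.enorm_eq_ofReal_abs, ENNReal.ofReal_le_ofReal_iff (by positivity)] at this
      exact this)
  rw [abs_sub_comm]
  simpa using hmv

end Estimates

/-! ### Geometry of Lipschitz domains and continuous representatives -/

section ContinuousRepresentative

variable {d : ℕ} {Ω : Set (EuclideanSpace ℝ (Fin d))} {u w : EuclideanSpace ℝ (Fin d) → ℝ}

local notation "E" => EuclideanSpace ℝ (Fin d)

theorem norm_sub_inner_smul_le {n v : E} (hn : ‖n‖ = 1) : ‖v - inner ℝ n v • n‖ ≤ 2 * ‖v‖ := by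
  have h1 : ‖inner ℝ n v • n‖ ≤ ‖v‖ := by
    rw [norm_smul, hn, mul_one, Real.norm_eq_abs]
    simpa [hn] using abs_real_inner_le_norm n v
  linarith [norm_sub_le v (inner ℝ n v • n)]

/-- A translation along `n` leaves the tangential coordinates unchanged, so only `v` moves the
argument of the graph function. -/
theorem LipschitzWith.le_add_of_add {L : NNReal} {γ : E → ℝ} (hγ : LipschitzWith L γ) {n : E}
    (hn : ‖n‖ = 1) (x v : E) (t : ℝ) :
    |γ (x + t • n + v - inner ℝ n (x + t • n + v) • n) - γ (x - inner ℝ n x • n)| ≤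
      2 * L * ‖v‖ := by
  have h := hγ.dist_le_mul (x + t • n + v - inner ℝ n (x + t • n + v) • n) (x - inner ℝ n x • n)
  rw [Real.dist_eq, dist_eq_norm] at h
  refine h.trans ?_
  have e : x + t • n + v - inner ℝ n (x + t • n + v) • n - (x - inner ℝ n x • n) =
      v - inner ℝ n v • n := by
    simp only [inner_add_right, inner_smul_right, real_inner_self_eq_norm_sq, hn, add_smul]
    norm_num
    abel
  rw [e]
  nlinarith [norm_sub_inner_smul_le (v := v) hn, L.coe_nonneg]

theorem inner_add_smul_add {n : E} (hn : ‖n‖ = 1) (x v : E) (t : ℝ) :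
    inner ℝ n (x + t • n + v) = inner ℝ n x + t + inner ℝ n v := by
  simp [inner_add_right, inner_smul_right, hn]

/-- The uniform interior cone condition of a Lipschitz domain. -/
theorem IsLipschitzDomain.exists_cone (hΩ : IsLipschitzDomain Ω) {z : E} (hz : z ∈ closure Ω) :
    ∃ (n : E) (c ρ s₀ : ℝ), 0 < c ∧ 0 < ρ ∧ 0 < s₀ ∧ ∀ x ∈ Ω, x ∈ ball z ρ → ∀ s, 0 < s → s ≤ s₀ →
      ∀ y ∈ ball (x + s • n) (s * c), segment ℝ x y ⊆ Ω := by
  by_cases hzΩ : z ∈ Ω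
  · obtain ⟨r, hr, hrΩ⟩ := Metric.isOpen_iff.1 hΩ.isOpen z hzΩ
    -- Inside $\Omega$ no direction is needed: with axis $0$ the cones are balls centred at $x$.
    refine ⟨0, 1, r / 2, r / 2, one_pos, by positivity, by positivity, ?_⟩
    intro x _ hxz s hs hs' y hy
    refine ((convex_ball z r).segment_subset ?_ ?_).trans hrΩ
    · exact ball_subset_ball (by linarith) hxz
    · simp only [smul_zero, add_zero, mul_one, mem_ball] at hy hxz ⊢
      linarith [dist_triangle y x z]
  · obtain ⟨r, n, L, γ, hr, hn, hγ, hiff⟩ := hΩ.locally_epigraph z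
      (by rw [hΩ.isOpen.frontier_eq]; exact ⟨hz, hzΩ⟩)
    have hL := L.coe_nonneg
    -- A displacement `v` changes the graph function by at most $2L\|v\|$ and the height by at most
    -- $\|v\|$; the rise $s$ along the axis wins if $(2L+1)\|v\|<s$.
    refine ⟨n, 1 / (2 * L + 1), r / 2, r / 4, by positivity, by positivity, by positivity, ?_⟩
    intro x hx hxz s hs hs' y hy p hp
    rw [segment_eq_image'] at hp
    obtain ⟨τ, ⟨hτ0, hτ1⟩, rfl⟩ := hp
    obtain ⟨v, rfl⟩ : ∃ v, y = x + s • n + v := ⟨y - (x + s • n), by abel⟩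
    have hv : ‖v‖ < s * (1 / (2 * L + 1)) := by simpa [dist_eq_norm] using hy
    have hc1 : 1 / (2 * (L : ℝ) + 1) ≤ 1 := by
      rw [div_le_one (by positivity)]; linarith
    have hvs : ‖v‖ ≤ s := hv.le.trans (by nlinarith)
    have hv' : ‖v‖ * (2 * L + 1) < s := by
      rw [mul_one_div, lt_div_iff₀ (by positivity)] at hv
      exact hv
    have e : x + τ • (x + s • n + v - x) = x + (τ * s) • n + τ • v := by
      rw [show x + s • n + v - x = s • n + v by abel, smul_add, mul_smul, add_assoc]
    change x + τ • (x + s • n + v - x) ∈ Ω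
    rw [e]
    rcases hτ0.eq_or_lt with rfl | hτ
    · simpa using hx
    refine (hiff _ ?_).2 ?_
    · rw [mem_ball, dist_eq_norm] at hxz ⊢
      have h1 : ‖x + (τ * s) • n + τ • v - z‖ ≤ ‖x - z‖ + ‖(τ * s) • n‖ + ‖τ • v‖ := by
        rw [show x + (τ * s) • n + τ • v - z = (x - z) + (τ * s) • n + τ • v by abel]
        exact norm_add₃_le
      rw [norm_smul, norm_smul, hn, Real.norm_of_nonneg (by positivity),
        Real.norm_of_nonneg hτ0] at h1
      nlinarith
    · have h1 := hγ.le_add_of_add hn x (τ • v) (τ * s)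
      have h2 := (hiff x (ball_subset_ball (by linarith) hxz)).1 hx
      rw [inner_add_smul_add hn] at h1 ⊢
      have h3 := abs_real_inner_le_norm n (τ • v)
      rw [hn, one_mul] at h3
      rw [norm_smul, Real.norm_of_nonneg hτ0] at h1 h3
      have h4 := (abs_le.1 h1).2
      have h5 := (abs_le.1 h3).1
      have h6 := mul_lt_mul_of_pos_left hv' hτ
      linarith

/-- A Lipschitz domain has no slits. Just below a boundary point along the axis lies a neighbourhood
disjoint from $\Omega$, so the boundary point is not interior to the closure. This places the open
simplices of a mesh of $\overline\Omega$ inside $\Omega$. -/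
theorem IsLipschitzDomain.interior_closure_subset (hΩ : IsLipschitzDomain Ω) :
    interior (closure Ω) ⊆ Ω := by
  intro z hz
  by_contra hzΩ
  obtain ⟨r, n, L, γ, hr, hn, hγ, hiff⟩ := hΩ.locally_epigraph z
    (by rw [hΩ.isOpen.frontier_eq]; exact ⟨interior_subset hz, hzΩ⟩)
  have hL := L.coe_nonneg
  have hz0 : inner ℝ n z ≤ γ (z - inner ℝ n z • n) :=
    not_lt.1 fun h => hzΩ ((hiff z (mem_ball_self hr)).2 h)
  obtain ⟨δ, hδ, hδΩ⟩ := Metric.isOpen_iff.1 isOpen_interior z hz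
  set t := min (δ / 2) (r / 4) with ht
  have ht0 : 0 < t := by positivity
  have hq : z + (-t) • n ∈ closure Ω := by
    refine interior_subset (hδΩ ?_)
    rw [mem_ball, dist_eq_norm, add_sub_cancel_left, norm_smul, hn, norm_neg,
      Real.norm_of_nonneg ht0.le]
    linarith [min_le_left (δ / 2) (r / 4)]
  obtain ⟨q, hqΩ, hqd⟩ := Metric.mem_closure_iff.1 hq (t / (2 * L + 1)) (by positivity)
  obtain ⟨v, rfl⟩ : ∃ v, q = z + (-t) • n + v := ⟨q - (z + (-t) • n), by abel⟩
  have hv : ‖v‖ < t / (2 * L + 1) := by simpa [dist_eq_norm] using hqd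
  have hv' : ‖v‖ * (2 * L + 1) < t := by
    rw [lt_div_iff₀ (by positivity)] at hv
    exact hv
  have hvt : ‖v‖ ≤ t := by nlinarith [norm_nonneg v]
  have h2 := (hiff _ (by
    rw [mem_ball, dist_eq_norm]
    have h1 : ‖z + (-t) • n + v - z‖ ≤ ‖(-t) • n‖ + ‖v‖ := by
      rw [show z + (-t) • n + v - z = (-t) • n + v by abel]
      exact norm_add_le _ _
    rw [norm_smul, hn, norm_neg, Real.norm_of_nonneg ht0.le] at h1
    linarith [min_le_right (δ / 2) (r / 4)])).1 hqΩ
  rw [inner_add_smul_add hn] at h2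
  have h1 := (abs_le.1 (hγ.le_add_of_add hn z v (-t))).1
  rw [inner_add_smul_add hn] at h1
  have h3 := abs_real_inner_le_norm n v
  rw [hn, one_mul] at h3
  have h4 := (abs_le.1 h3).2
  linarith

theorem subset_closure_of_ae_mem {U S : Set E} (hU : IsOpen U)
    (hS : ∀ᵐ x ∂volume.restrict U, x ∈ S) : U ⊆ closure (S ∩ U) := by
  intro x hx
  rw [Metric.mem_closure_iff]
  intro ε hε
  by_contra! h
  have h1 := (ae_restrict_iff' hU.measurableSet).1 hS
  have h2 : volume (U ∩ ball x ε) = 0 := by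
    refine measure_mono_null (fun y hy => ?_) (ae_iff.1 h1)
    intro hy'
    have := h y ⟨hy' hy.1, hy.1⟩
    rw [dist_comm] at this
    exact absurd hy.2 (not_lt.2 this)
  exact ((hU.inter isOpen_ball).measure_pos volume ⟨x, hx, mem_ball_self hε⟩).ne' h2

/-- A full-measure set is dense in $\Omega$, and small oscillation near every point of the closure
is the Cauchy criterion for limits along `S`. At the points of `S` in $\Omega$ the limit is the
value of `f` itself. -/
theorem exists_isContRep {f : E → ℝ} {S : Set E} (hΩ : IsOpen Ω)
    (hS : ∀ᵐ x ∂volume.restrict Ω, x ∈ S)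
    (hf : ∀ z ∈ closure Ω, ∀ ε > 0, ∃ ρ > 0, ∀ x ∈ S, x ∈ ball z ρ → ∀ x' ∈ S, x' ∈ ball z ρ →
      |f x - f x'| < ε) : ∃ f', IsContRep Ω f f' ∧ ∀ x ∈ S ∩ Ω, f' x = f x := by
  have hcl : closure Ω ⊆ closure S :=
    closure_minimal ((subset_closure_of_ae_mem hΩ hS).trans (closure_mono inter_subset_left))
      isClosed_closure
  have hlim : ∀ z ∈ closure Ω, ∃ y, Tendsto f (𝓝[S] z) (𝓝 y) := by
    intro z hz
    have : (𝓝[S] z).NeBot := mem_closure_iff_nhdsWithin_neBot.1 (hcl hz)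
    rw [← cauchy_map_iff_exists_tendsto, Metric.cauchy_iff]
    refine ⟨inferInstance, fun ε hε => ?_⟩
    obtain ⟨ρ, hρ, h⟩ := hf z hz ε hε
    refine ⟨f '' (S ∩ ball z ρ), image_mem_map (inter_mem_nhdsWithin _ (ball_mem_nhds z hρ)), ?_⟩
    rintro _ ⟨x, hx, rfl⟩ _ ⟨x', hx', rfl⟩
    exact h x hx.1 hx.2 x' hx'.1 hx'.2
  have hext : ∀ x ∈ S ∩ Ω, extendFrom S f x = f x := by
    intro x hx
    obtain ⟨y, hy⟩ := hlim x (subset_closure hx.2)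
    rw [extendFrom_eq (subset_closure hx.1) hy]
    exact (tendsto_nhds_unique ((tendsto_pure_nhds f x).mono_right le_rfl)
      (hy.mono_left (pure_le_nhdsWithin hx.1))).symm
  refine ⟨extendFrom S f, ⟨continuousOn_extendFrom hcl hlim, ?_⟩, hext⟩
  filter_upwards [hS, ae_restrict_mem hΩ.measurableSet] with x hx hxΩ
  exact hext x ⟨hx, hxΩ⟩

theorem exists_isContRep_of_memW1Inf (hΩ : IsLipschitzDomain Ω) (hw : MemW1Inf Ω w) :
    ∃ w', IsContRep Ω w w' ∧ ∀ K ⊆ Ω, IsOpen K → Convex ℝ K → ∀ x ∈ closure K, ∀ y ∈ closure K,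
      |w' x - w' y| ≤ lpNormOn Ω ∞ (weakGrad Ω w) * ‖x - y‖ := by
  obtain ⟨S, hSΩ, hS, hlip⟩ := exists_lipschitz_set hΩ.isOpen hΩ.isBounded hw
  set M := lpNormOn Ω ∞ (weakGrad Ω w) with hM
  have hM0 : 0 ≤ M := ENNReal.toReal_nonneg
  obtain ⟨w', hw', hw'S⟩ := exists_isContRep (f := w) hΩ.isOpen hS (by
    intro z hz ε hε
    obtain ⟨n, c, ρ, s₀, hc, hρ, hs₀, hcone⟩ := hΩ.exists_cone hz
    -- Points near $z$ are compared through one point $y$ of a ball common to their cones, at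
    -- distance at most $s(c+\|n\|)$; this $s$ makes the two errors together less than
    -- $\varepsilon$.
    set s := min s₀ (ε / (2 * (M + 1) * (c + ‖n‖) + 1)) with hs
    have hs0 : 0 < s := by positivity
    have hsε : 2 * (M * (s * (c + ‖n‖))) < ε := by
      have h1 : s ≤ ε / (2 * (M + 1) * (c + ‖n‖) + 1) := min_le_right _ _
      rw [le_div_iff₀ (by positivity)] at h1
      nlinarith [mul_pos hs0 (add_pos_of_pos_of_nonneg hc (norm_nonneg n))]
    refine ⟨min ρ (s * c / 2), by positivity, fun x hx hxz x' hx' hxz' => ?_⟩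
    have hsub : ∀ p ∈ ball z (min ρ (s * c / 2)),
        ball (z + s • n) (s * c / 2) ⊆ ball (p + s • n) (s * c) := by
      intro p hp
      refine ball_subset_ball' ?_
      rw [dist_add_right, dist_comm]
      linarith [mem_ball.1 hp, min_le_right ρ (s * c / 2)]
    have hball : ball (z + s • n) (s * c / 2) ⊆ Ω := fun y hy =>
      hcone x (hSΩ hx) (ball_subset_ball (min_le_left _ _) hxz) s hs0 (min_le_left _ _) y
        (hsub x hxz hy) (right_mem_segment ℝ x y)
    obtain ⟨y, hyS, hy⟩ : (S ∩ ball (z + s • n) (s * c / 2)).Nonempty := by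
      have h := subset_closure_of_ae_mem isOpen_ball
        (ae_mono (Measure.restrict_mono hball le_rfl) hS)
        (mem_ball_self (by positivity : 0 < s * c / 2))
      exact closure_nonempty_iff.1 ⟨_, h⟩
    have hb : ∀ p ∈ S, p ∈ ball z (min ρ (s * c / 2)) → |w p - w y| ≤ M * (s * (c + ‖n‖)) := by
      intro p hp hpz
      have hyp := hsub p hpz hy
      refine (hlip p hp y hyS (hcone p (hSΩ hp) (ball_subset_ball (min_le_left _ _) hpz) s hs0
        (min_le_left _ _) y hyp)).trans ?_
      refine mul_le_mul_of_nonneg_left ?_ hM0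
      have h1 : ‖p - y‖ ≤ ‖y - (p + s • n)‖ + ‖s • n‖ := by
        rw [norm_sub_rev p y]
        calc ‖y - p‖ = ‖(y - (p + s • n)) + s • n‖ := by congr 1; abel
          _ ≤ _ := norm_add_le _ _
      rw [mem_ball, dist_eq_norm] at hyp
      rw [norm_smul, Real.norm_of_nonneg hs0.le] at h1
      linarith
    have h1 := hb x hx hxz
    have h2 := hb x' hx' hxz'
    rw [abs_sub_comm] at h2
    linarith [abs_sub_le (w x) (w y) (w x')])
  refine ⟨w', hw', fun K hK hKo hKc x hx y hy => ?_⟩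
  -- The good points of `K` are dense in its closure, and the Lipschitz bound is a closed condition
  -- on pairs.
  have hcl := closure_minimal (subset_closure_of_ae_mem hKo
    (ae_mono (Measure.restrict_mono hK le_rfl) hS)) isClosed_closure
  have hsc : S ∩ K ⊆ closure Ω := fun p hp => subset_closure (hK hp.2)
  have hcont : ContinuousOn (fun p : E × E => M * ‖p.1 - p.2‖ - |w' p.1 - w' p.2|)
      (closure (S ∩ K) ×ˢ closure (S ∩ K)) := by
    have hw1 := hw'.1.mono (closure_minimal hsc isClosed_closure)
    refine ContinuousOn.sub (by fun_prop) (ContinuousOn.abs (ContinuousOn.sub ?_ ?_))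
    · exact hw1.comp continuousOn_fst fun p hp => hp.1
    · exact hw1.comp continuousOn_snd fun p hp => hp.2
  rw [← closure_prod_eq] at hcont
  have := hcont.image_closure ⟨(x, y), by rw [closure_prod_eq]; exact ⟨hcl hx, hcl hy⟩, rfl⟩
  have hnn := closure_minimal (t := Ici (0 : ℝ)) (by
    rintro _ ⟨⟨p, q⟩, ⟨hp, hq⟩, rfl⟩
    have hl := hlip p hp.1 q hq.1 ((hKc.segment_subset hp.2 hq.2).trans hK)
    simp only [mem_Ici, hw'S p ⟨hp.1, hK hp.2⟩, hw'S q ⟨hq.1, hK hq.2⟩]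
    linarith) isClosed_Ici this
  simp only [mem_Ici] at hnn
  linarith

end ContinuousRepresentative

/-! ### Continuity of functions in $H^2$ and Taylor's formula up to the boundary -/

section SobolevEmbedding

variable {d : ℕ} {Ω : Set (EuclideanSpace ℝ (Fin d))} {u w : EuclideanSpace ℝ (Fin d) → ℝ}

local notation "E" => EuclideanSpace ℝ (Fin d)

theorem enorm_add_add_sq_le (a b c : ℝ) :
    ‖a + b + c‖ₑ ^ 2 ≤ 3 * (‖a‖ₑ ^ 2 + ‖b‖ₑ ^ 2 + ‖c‖ₑ ^ 2) := by
  have h : ∀ t : ℝ, ‖t‖ₑ ^ 2 = ENNReal.ofReal (t ^ 2) := fun t => by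
    rw [Real.enorm_eq_ofReal_abs, ← ENNReal.ofReal_pow (abs_nonneg t), sq_abs]
  rw [h, h, h, h, ← ENNReal.ofReal_add (by positivity) (by positivity),
    ← ENNReal.ofReal_add (by positivity) (by positivity),
    show (3 : ℝ≥0∞) = ENNReal.ofReal 3 by norm_num, ← ENNReal.ofReal_mul (by norm_num)]
  refine ENNReal.ofReal_le_ofReal ?_
  nlinarith [sq_nonneg (a - b), sq_nonneg (b - c), sq_nonneg (a - c)]

theorem lintegral_enorm_sq_lt_top {α F : Type*} [MeasurableSpace α] [NormedAddCommGroup F]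
    {μ : Measure α} {f : α → F} (hf : MemLp f 2 μ) : ∫⁻ x, ‖f x‖ₑ ^ 2 ∂μ < ⊤ := by
  have := lintegral_rpow_enorm_lt_top_of_eLpNorm_lt_top (by norm_num) (by norm_num) hf.2
  simpa using this

theorem memLp_hessNorm (hu : MemH2 Ω u) : MemLp (hessNorm Ω u) 2 (volume.restrict Ω) := by
  rw [memLp_two_iff_integrable_sq (aestronglyMeasurable_hessNorm hu)]
  have h : ∀ x, hessNorm Ω u x ^ 2 = ∑ i, ∑ j, weakPartial Ω j (weakPartial Ω i u) x ^ 2 :=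
    fun x => Real.sq_sqrt (by positivity)
  simp only [h]
  exact integrable_finsetSum _ fun i _ => integrable_finsetSum _ fun j _ =>
    (hu.2.2 i j).2.integrable_sq

theorem aemeasurable_taylorRem (hu : MemH2 Ω u) (c : ℝ) (x : E) :
    AEMeasurable (taylorRem Ω u c x) (volume.restrict Ω) := by
  have h1 := (memLp_weakGrad fun i => (hu.2.1 i).2 : MemLp (weakGrad Ω u) 2 _).1.aemeasurable
  have h2 := hu.1.1.aemeasurable
  unfold taylorRem
  fun_prop

/-- The numerator is of order $s^4$ and the volume of the averaging ball of order $s^d$; their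
quotient is $O(s)$ since $d\le3$ and $s\le1$. -/
theorem sq_sub_mul_le (hd : d ≤ 3) {A B h δ κ s Δ : ℝ} (hs : 0 < s) (hs1 : s ≤ 1)
    (hκ : 0 < κ) (hh : h ^ 4 = s ^ 4 * δ)
    (h1 : Δ ^ 2 * (s ^ d * κ) ≤ 3 * (2 * (4 * h ^ 4 * A) + (s ^ 2) ^ 2 * B)) :
    Δ ^ 2 ≤ s * (3 * (8 * δ * A + B) / κ) := by
  have h2 : Δ ^ 2 * (s ^ d * κ) ≤ s ^ 4 * (3 * (8 * δ * A + B)) := by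
    rw [hh] at h1; linarith
  have hX : 0 ≤ 3 * (8 * δ * A + B) := by
    have := le_trans (by positivity) h2
    exact nonneg_of_mul_nonneg_right this (by positivity)
  have h3 : s ^ 4 ≤ s ^ d * s := by
    rw [← pow_succ]
    exact pow_le_pow_of_le_one hs.le hs1 (by omega)
  rw [← mul_div_assoc, le_div_iff₀ hκ]
  have h4 : s ^ d * (Δ ^ 2 * κ) ≤ s ^ d * (s * (3 * (8 * δ * A + B))) := by
    nlinarith [mul_le_mul_of_nonneg_right h3 hX]
  exact le_of_mul_le_mul_left h4 (by positivity)

/-- Average over $y\in B$ the identity expressing $u(x)-u(x')$ as the difference of the Taylor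
remainders at $x$ and $x'$ plus $\nabla u(y)\cdot(x-x')$. -/
theorem sub_sq_mul_volume_le (hu : MemH2 Ω u) {B : Set E} (hBΩ : B ⊆ Ω)
    {x x' : E} {X : ℝ≥0∞} (hx : ∫⁻ y in B, ‖taylorRem Ω u (u x) x y‖ₑ ^ 2 ≤ X)
    (hx' : ∫⁻ y in B, ‖taylorRem Ω u (u x') x' y‖ₑ ^ 2 ≤ X) :
    ‖u x - u x'‖ₑ ^ 2 * volume B ≤
      3 * (2 * X + ‖x - x'‖ₑ ^ 2 * ∫⁻ y in Ω, ‖weakGrad Ω u y‖ₑ ^ 2) := by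
  have hr := Measure.restrict_mono hBΩ (le_refl volume)
  have m1 := (aemeasurable_taylorRem hu (u x) x).mono_measure hr
  have m2 := (aemeasurable_taylorRem hu (u x') x').mono_measure hr
  have m3 := (memLp_weakGrad fun i => (hu.2.1 i).2 :
    MemLp (weakGrad Ω u) 2 _).1.aemeasurable.mono_measure hr
  calc ‖u x - u x'‖ₑ ^ 2 * volume B = ∫⁻ y in B, ‖u x - u x'‖ₑ ^ 2 := by simp
    _ ≤ ∫⁻ y in B, 3 * (‖taylorRem Ω u (u x) x y‖ₑ ^ 2 + ‖taylorRem Ω u (u x') x' y‖ₑ ^ 2 +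
          ‖inner ℝ (weakGrad Ω u y) (x - x')‖ₑ ^ 2) := by
      refine lintegral_mono fun y => ?_
      have e : u x - u x' = taylorRem Ω u (u x) x y + - taylorRem Ω u (u x') x' y +
          inner ℝ (weakGrad Ω u y) (x - x') := by
        rw [taylorRem, taylorRem, show x - x' = (x - y) - (x' - y) by abel, inner_sub_right _ (x - y)]
        ring
      conv_lhs => rw [e]
      simpa only [enorm_neg] using enorm_add_add_sq_le (taylorRem Ω u (u x) x y)
        (- taylorRem Ω u (u x') x' y) (inner ℝ (weakGrad Ω u y) (x - x'))
    _ = 3 * ((∫⁻ y in B, ‖taylorRem Ω u (u x) x y‖ₑ ^ 2) +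
          (∫⁻ y in B, ‖taylorRem Ω u (u x') x' y‖ₑ ^ 2) +
          ∫⁻ y in B, ‖inner ℝ (weakGrad Ω u y) (x - x')‖ₑ ^ 2) := by
      rw [lintegral_const_mul'' _ (by fun_prop), lintegral_add_left' (by fun_prop),
        lintegral_add_left' (by fun_prop)]
    _ ≤ _ := by
      rw [two_mul]
      gcongr
      rw [← lintegral_const_mul'' _ (by
        have := (memLp_weakGrad fun i => (hu.2.1 i).2 : MemLp (weakGrad Ω u) 2 _).1.aemeasurable
        fun_prop)]
      refine (lintegral_mono_set hBΩ).trans (lintegral_mono fun y => ?_)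
      rw [← mul_pow, mul_comm]
      gcongr
      rw [← ofReal_norm, ← ofReal_norm, ← ofReal_norm,
        ← ENNReal.ofReal_mul (norm_nonneg _)]
      exact ENNReal.ofReal_le_ofReal (norm_inner_le_norm _ _)

/-- Functions in `H²(Ω)` have a continuous representative, which satisfies Taylor's formula in the
mean up to the boundary of each convex open subset of `Ω`. -/
theorem exists_isContRep_of_memH2 (hd : d ≤ 3) (hΩ : IsLipschitzDomain Ω) (hu : MemH2 Ω u) :
    ∃ u', IsContRep Ω u u' ∧ ∀ K ⊆ Ω, IsOpen K → Convex ℝ K → ∀ x ∈ closure K, ∀ h : ℝ,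
      (∀ a ∈ K, ∀ b ∈ K, ‖a - b‖ ≤ h) →
      ∫⁻ y in K, ‖taylorRem Ω u (u' x) x y‖ₑ ^ 2 ≤
        ENNReal.ofReal (4 * h ^ 4) * ∫⁻ z in K, ‖hessNorm Ω u z‖ₑ ^ 2 := by
  have hS := ae_lintegral_taylorRem_le hd hΩ.isOpen hΩ.isBounded hu
  set S := {x : E | x ∈ Ω ∧ ∀ (U B : Set E) (h : ℝ), IsOpen U → U ⊆ Ω →
      MeasurableSet B → (∀ y ∈ B, segment ℝ x y ⊆ U) → (∀ y ∈ B, ‖y - x‖ ≤ h) →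
      ∫⁻ y in B, ‖taylorRem Ω u (u x) x y‖ₑ ^ 2 ≤
        ENNReal.ofReal (4 * h ^ 4) * ∫⁻ z in U, ‖hessNorm Ω u z‖ₑ ^ 2} with hSdef
  have hS' : ∀ᵐ x ∂volume.restrict Ω, x ∈ S := by
    filter_upwards [hS, ae_restrict_mem hΩ.isOpen.measurableSet] with x h1 h2
    exact ⟨h2, h1⟩
  obtain ⟨A, hA0, hA⟩ : ∃ A : ℝ, 0 ≤ A ∧ ∫⁻ z in Ω, ‖hessNorm Ω u z‖ₑ ^ 2 = ENNReal.ofReal A :=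
    ⟨_, ENNReal.toReal_nonneg, (ENNReal.ofReal_toReal
      (lintegral_enorm_sq_lt_top (memLp_hessNorm hu)).ne).symm⟩
  obtain ⟨G, hG0, hG⟩ : ∃ G : ℝ, 0 ≤ G ∧ ∫⁻ z in Ω, ‖weakGrad Ω u z‖ₑ ^ 2 = ENNReal.ofReal G :=
    ⟨_, ENNReal.toReal_nonneg, (ENNReal.ofReal_toReal
      (lintegral_enorm_sq_lt_top (memLp_weakGrad fun i => (hu.2.1 i).2)).ne).symm⟩
  obtain ⟨u', hu', hu'S⟩ := exists_isContRep (f := u) hΩ.isOpen hS' (by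
    intro z hz ε hε
    obtain ⟨n, c, ρ, s₀, hc, hρ, hs₀, hcone⟩ := hΩ.exists_cone hz
    set k := c + ‖n‖ with hk
    have hk0 : 0 < k := by positivity
    obtain ⟨b₀, hb₀0, hb₀⟩ : ∃ b₀ : ℝ, 0 < b₀ ∧ volume (ball (0 : E) 1) = ENNReal.ofReal b₀ :=
      ⟨_, ENNReal.toReal_pos (measure_ball_pos volume _ one_pos).ne' measure_ball_lt_top.ne,
        (ENNReal.ofReal_toReal measure_ball_lt_top.ne).symm⟩
    set κ := (c / 2) ^ d * b₀ with hκ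
    have hκ0 : 0 < κ := by positivity
    set D := 3 * (8 * k ^ 4 * A + G) / κ with hD
    have hD0 : 0 ≤ D := by positivity
    set s := min (min s₀ 1) (ε ^ 2 / (D + 1)) with hs
    have hs0 : 0 < s := by positivity
    have hss₀ : s ≤ s₀ := (min_le_left _ _).trans (min_le_left _ _)
    have hs1 : s ≤ 1 := (min_le_left _ _).trans (min_le_right _ _)
    have hsε : s * D < ε ^ 2 := by
      have h1 : s ≤ ε ^ 2 / (D + 1) := min_le_right _ _
      rw [le_div_iff₀ (by positivity)] at h1
      linarith
    -- The bound $s^2/2$ forces $\|x-x'\|\le s^2$, so the gradient term is of order $s^4$, like the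
    -- remainders; $sc/2$ gives the cones a common ball.
    set r := min ρ (min (s * c / 2) (s ^ 2 / 2)) with hr
    have hrρ : r ≤ ρ := min_le_left _ _
    have hrc : r ≤ s * c / 2 := (min_le_right _ _).trans (min_le_left _ _)
    have hrs : r ≤ s ^ 2 / 2 := (min_le_right _ _).trans (min_le_right _ _)
    set B := ball (z + s • n) (s * c / 2) with hB
    have hsub : ∀ p ∈ ball z r, B ⊆ ball (p + s • n) (s * c) := by
      intro p hp
      refine ball_subset_ball' ?_
      rw [dist_add_right, dist_comm]
      linarith [mem_ball.1 hp]
    have hbd : ∀ p ∈ S, p ∈ ball z r → ∫⁻ y in B, ‖taylorRem Ω u (u p) p y‖ₑ ^ 2 ≤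
        ENNReal.ofReal (4 * (s * k) ^ 4 * A) := by
      intro p hp hpz
      have := hp.2 Ω B (s * k) hΩ.isOpen subset_rfl measurableSet_ball
        (fun y hy => hcone p hp.1 (ball_subset_ball hrρ hpz) s hs0 hss₀ y (hsub p hpz hy))
        (fun y hy => by
          have h1 : ‖y - p‖ ≤ ‖y - (p + s • n)‖ + ‖s • n‖ :=
            calc ‖y - p‖ = ‖(y - (p + s • n)) + s • n‖ := by congr 1; abel
              _ ≤ _ := norm_add_le _ _
          have hyp := hsub p hpz hy
          rw [mem_ball, dist_eq_norm] at hyp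
          rw [norm_smul, Real.norm_of_nonneg hs0.le] at h1
          linarith)
      rwa [hA, ← ENNReal.ofReal_mul (by positivity)] at this
    refine ⟨r, by positivity, fun x hx hxz x' hx' hxz' => ?_⟩
    have hBΩ : B ⊆ Ω := fun y hy => hcone x hx.1 (ball_subset_ball hrρ hxz) s hs0 hss₀ y
      (hsub x hxz hy) (right_mem_segment ℝ x y)
    have h1 := sub_sq_mul_volume_le hu hBΩ (hbd x hx hxz) (hbd x' hx' hxz')
    have hvol : volume B = ENNReal.ofReal (s ^ d * κ) := by
      rw [hB, Measure.addHaar_ball_of_pos _ _ (by positivity), hb₀, finrank_euclideanSpace_fin,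
        ← ENNReal.ofReal_mul (by positivity), hκ, ← mul_assoc, ← mul_pow, mul_div_assoc]
    have hxx : ‖x - x'‖ ≤ s ^ 2 := by
      rw [← dist_eq_norm]
      rw [mem_ball] at hxz hxz'
      linarith [dist_triangle_right x x' z]
    have h2 : ‖u x - u x'‖ₑ ^ 2 * volume B ≤ ENNReal.ofReal
        (3 * (2 * (4 * (s * k) ^ 4 * A) + (s ^ 2) ^ 2 * G)) := by
      refine h1.trans ?_
      rw [hG, ENNReal.ofReal_mul (p := 3) (by norm_num), ENNReal.ofReal_add (by positivity) (by positivity),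
        ENNReal.ofReal_mul (p := 2) (by norm_num), ENNReal.ofReal_mul (p := (s ^ 2) ^ 2)
        (by positivity), ENNReal.ofReal_pow (by positivity), ← ofReal_norm,
        ENNReal.ofReal_ofNat, ENNReal.ofReal_ofNat]
      gcongr
    rw [hvol, Real.enorm_eq_ofReal_abs, ← ENNReal.ofReal_pow (abs_nonneg _), sq_abs,
      ← ENNReal.ofReal_mul (by positivity), ENNReal.ofReal_le_ofReal_iff (by positivity)] at h2
    have h3 := sq_sub_mul_le hd hs0 hs1 hκ0 (mul_pow s k 4) h2
    exact abs_lt_of_sq_lt_sq (h3.trans_lt hsε) hε.le)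
  refine ⟨u', hu', fun K hK hKo hKc x hx h hh => ?_⟩
  have hcl := closure_minimal (subset_closure_of_ae_mem hKo
    (ae_mono (Measure.restrict_mono hK le_rfl) hS')) isClosed_closure
  -- The point `x`, in the application a vertex, need not be a good point. It is a limit of good
  -- points of `K`, for which the estimate holds with a bound independent of the point; continuity
  -- of $u'$ and Fatou's lemma conclude.
  obtain ⟨xs, hxs, hlim⟩ := mem_closure_iff_seq_limit.1 (hcl hx)
  have hux : Tendsto (fun n => u' (xs n)) atTop (𝓝 (u' x)) :=
    (hu'.1 x (closure_mono hK hx)).tendsto.comp (tendsto_nhdsWithin_iff.2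
      ⟨hlim, Eventually.of_forall fun n => subset_closure (hxs n).1.1⟩)
  have hm : ∀ n, AEMeasurable (fun y => ‖taylorRem Ω u (u' (xs n)) (xs n) y‖ₑ ^ 2)
      (volume.restrict K) := fun n =>
    ((aemeasurable_taylorRem hu _ _).mono_measure (Measure.restrict_mono hK le_rfl)).enorm.pow_const 2
  have hT : ∀ y, ‖taylorRem Ω u (u' x) x y‖ₑ ^ 2 =
      liminf (fun n => ‖taylorRem Ω u (u' (xs n)) (xs n) y‖ₑ ^ 2) atTop := by
    intro y
    refine (Tendsto.liminf_eq ?_).symm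
    refine ((ENNReal.continuous_pow 2).tendsto _).comp ((continuous_enorm.tendsto _).comp ?_)
    unfold taylorRem
    exact (hux.sub_const _).sub (tendsto_const_nhds.inner (hlim.sub_const y))
  simp only [hT]
  refine (lintegral_liminf_le' hm).trans ?_
  refine (liminf_le_liminf (Eventually.of_forall fun n => ?_)).trans (liminf_const _).le
  obtain ⟨⟨hnΩ, hnS⟩, hnK⟩ := hxs n
  rw [hu'S _ ⟨⟨hnΩ, hnS⟩, hnΩ⟩]
  exact hnS K K h hKo hK hKo.measurableSet (fun y hy => hKc.segment_subset hnK hy)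
    fun y hy => hh y hy _ hnK

end SobolevEmbedding

/-! ### Geometry of the mesh: open cells, gradients of the basis functions, coefficients -/

namespace SimplicialMesh

variable {d : ℕ} {Ω : Set (EuclideanSpace ℝ (Fin d))} (T : SimplicialMesh Ω)

local notation "E" => EuclideanSpace ℝ (Fin d)

variable {T} {K K' : Finset (EuclideanSpace ℝ (Fin d))} {i j x : EuclideanSpace ℝ (Fin d)}

theorem range_cellBasis (hK : K ∈ T.cells) : range (T.cellBasis hK) = (K : Set E) := by
  change range ((↑) : K → E) = _
  simp

theorem cellBasis_apply (hK : K ∈ T.cells) (k : K) : T.cellBasis hK k = k := rfl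

/-- The interior of the simplex with vertices `K`. -/
def openCell (K : Finset (EuclideanSpace ℝ (Fin d))) : Set (EuclideanSpace ℝ (Fin d)) :=
  interior (convexHull ℝ (K : Set (EuclideanSpace ℝ (Fin d))))

theorem isOpen_openCell : IsOpen (openCell K) := isOpen_interior

theorem convex_openCell : Convex ℝ (openCell K) := (convex_convexHull ℝ _).interior

theorem openCell_subset : openCell K ⊆ convexHull ℝ (K : Set E) := interior_subset

theorem isCompact_convexHull_cell : IsCompact (convexHull ℝ (K : Set E)) :=
  K.finite_toSet.isCompact_convexHull ℝ

theorem mem_openCell_iff (hK : K ∈ T.cells) :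
    x ∈ openCell K ↔ ∀ i : K, 0 < (T.cellBasis hK).coord i x := by
  rw [openCell, ← range_cellBasis hK, AffineBasis.interior_convexHull]
  rfl

theorem mem_convexHull_iff (hK : K ∈ T.cells) :
    x ∈ convexHull ℝ (K : Set E) ↔ ∀ i : K, 0 ≤ (T.cellBasis hK).coord i x := by
  rw [← range_cellBasis hK, AffineBasis.convexHull_eq_nonneg_coord]
  rfl

theorem closure_openCell (hK : K ∈ T.cells) :
    closure (openCell K) = convexHull ℝ (K : Set E) := by
  have hne : (openCell K).Nonempty := by
    rw [openCell, interior_convexHull_nonempty_iff_affineSpan_eq_top, ← range_cellBasis hK]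
    exact (T.cellBasis hK).tot
  rw [openCell, (convex_convexHull ℝ _).closure_interior_eq_closure_of_nonempty_interior hne,
    isCompact_convexHull_cell.isClosed.closure_eq]

/-- By conformity the point lies in the hull of the common vertices. If a vertex of `K` were
missing, its barycentric coordinate would vanish there, whereas all coordinates are positive inside.
-/
theorem eq_of_mem_openCell (hK : K ∈ T.cells) (hK' : K' ∈ T.cells) (hx : x ∈ openCell K)
    (hx' : x ∈ convexHull ℝ (K' : Set E)) : K' = K := by
  classical
  have hsub : K ⊆ K' := by
    intro i hi
    by_contra hi'
    have h1 := T.inter_subset_convexHull (mem_cells.1 hK).1 (mem_cells.1 hK').1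
      ⟨openCell_subset hx, hx'⟩
    have h2 : convexHull ℝ ((K : Set E) ∩ K') ⊆ {y | (T.cellBasis hK).coord ⟨i, hi⟩ y = 0} := by
      refine convexHull_min ?_ ?_
      · rintro k ⟨hk, hk'⟩
        have hne : (⟨i, hi⟩ : K) ≠ ⟨k, hk⟩ := by
          intro h
          exact hi' (by rw [(Subtype.mk.injEq ..).mp h]; exact hk')
        have h := (T.cellBasis hK).coord_apply_ne hne
        rw [cellBasis_apply] at h
        exact h
      · exact (convex_singleton (0 : ℝ)).affine_preimage ((T.cellBasis hK).coord ⟨i, hi⟩)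
    have := (mem_openCell_iff hK).1 hx ⟨i, hi⟩
    rw [h2 h1] at this
    exact lt_irrefl _ this
  refine (Finset.eq_of_subset_of_card_le hsub ?_).symm
  rw [(mem_cells.1 hK).2, (mem_cells.1 hK').2]

theorem pairwiseDisjoint_openCell :
    (T.cells : Set (Finset E)).PairwiseDisjoint openCell := by
  intro K hK K' hK' hne
  rw [Function.onFun, Set.disjoint_left]
  exact fun x hx hx' => hne (eq_of_mem_openCell hK hK' hx (openCell_subset hx')).symm

theorem convexHull_subset_closure (hK : K ∈ T.cells) : convexHull ℝ (K : Set E) ⊆ closure Ω := by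
  rw [← T.space_eq]
  exact T.convexHull_subset_space (mem_cells.1 hK).1

theorem openCell_subset_domain (hΩ : IsLipschitzDomain Ω) (hK : K ∈ T.cells) : openCell K ⊆ Ω :=
  (interior_mono (convexHull_subset_closure hK)).trans hΩ.interior_closure_subset

theorem openCell_ae_eq : (openCell K : Set E) =ᵐ[volume] convexHull ℝ (K : Set E) :=
  interior_ae_eq_of_null_frontier ((convex_convexHull ℝ _).addHaar_frontier volume)

theorem closure_subset_biUnion : closure Ω ⊆ ⋃ K ∈ T.cells, convexHull ℝ (K : Set E) := by
  intro x hx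
  rw [← T.space_eq, Geometry.SimplicialComplex.mem_space_iff] at hx
  obtain ⟨s, hs, hxs⟩ := hx
  obtain ⟨t, ht, hst, hcard⟩ := T.pure s hs
  exact mem_biUnion (mem_cells.2 ⟨ht, hcard⟩)
    (convexHull_mono (by exact_mod_cast hst) hxs)

/-- The frontier of a convex set is null, and there are finitely many elements. -/
theorem ae_mem_openCell (T : SimplicialMesh Ω) : ∀ᵐ x, x ∈ closure Ω → ∃ K ∈ T.cells, x ∈ openCell K := by
  have h : ∀ᵐ x, ∀ K ∈ T.cells, (x ∈ openCell K) = (x ∈ convexHull ℝ (K : Set E)) :=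
    (T.cells.eventually_all).2 fun K _ => openCell_ae_eq
  filter_upwards [h] with x hx hxΩ
  obtain ⟨K, hK, hxK⟩ := mem_iUnion₂.1 (closure_subset_biUnion (T := T) hxΩ)
  exact ⟨K, hK, by rw [hx K hK]; exact hxK⟩

theorem biUnion_openCell_ae_eq (T : SimplicialMesh Ω) (hΩ : IsLipschitzDomain Ω) :
    (⋃ K ∈ T.cells, openCell K : Set E) =ᵐ[volume] Ω := by
  filter_upwards [T.ae_mem_openCell] with x hx
  refine propext ⟨fun h => ?_, fun h => ?_⟩
  · obtain ⟨K, hK, hxK⟩ := mem_iUnion₂.1 h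
    exact openCell_subset_domain hΩ hK hxK
  · obtain ⟨K, hK, hxK⟩ := hx (subset_closure h)
    exact mem_iUnion₂.2 ⟨K, hK, hxK⟩

theorem setIntegral_eq_sum (T : SimplicialMesh Ω) (hΩ : IsLipschitzDomain Ω) {f : E → ℝ}
    (hf : IntegrableOn f Ω) : ∫ x in Ω, f x = ∑ K ∈ T.cells, ∫ x in openCell K, f x := by
  rw [← integral_biUnion_finset _ (fun K _ => isOpen_openCell.measurableSet)
    pairwiseDisjoint_openCell (fun K hK => hf.mono_set (openCell_subset_domain hΩ hK))]
  exact setIntegral_congr_set (T.biUnion_openCell_ae_eq hΩ).symm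

variable (T) in
open Classical in
/-- The constant gradient, on the element `K`, of the Lagrange basis function of `i`. -/
def cellGrad (K : Finset (EuclideanSpace ℝ (Fin d))) (i : EuclideanSpace ℝ (Fin d)) :
    EuclideanSpace ℝ (Fin d) :=
  if h : ∃ _ : K ∈ T.cells, i ∈ K then (InnerProductSpace.toDual ℝ _).symm
    (LinearMap.toContinuousLinearMap ((T.cellBasis h.choose).coord ⟨i, h.choose_spec⟩).linear)
  else 0

theorem inner_cellGrad (hK : K ∈ T.cells) (hi : i ∈ K) (v : E) :
    inner ℝ (T.cellGrad K i) v = ((T.cellBasis hK).coord ⟨i, hi⟩).linear v := by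
  rw [cellGrad, dif_pos ⟨hK, hi⟩]
  simp

theorem cellGrad_eq_zero (hi : i ∉ K) : T.cellGrad K i = 0 :=
  dif_neg fun h => hi h.choose_spec

theorem inner_cellGrad_sub (hK : K ∈ T.cells) (hi : i ∈ K) (x y : E) :
    inner ℝ (T.cellGrad K i) (x - y) =
      (T.cellBasis hK).coord ⟨i, hi⟩ x - (T.cellBasis hK).coord ⟨i, hi⟩ y := by
  rw [inner_cellGrad hK hi, ← vsub_eq_sub x y, AffineMap.linearMap_vsub, vsub_eq_sub]

theorem hat_eq_coord (hK : K ∈ T.cells) (hi : i ∈ K) (hx : x ∈ openCell K) :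
    T.hat i x = (T.cellBasis hK).coord ⟨i, hi⟩ x := by
  have h : ∃ K, ∃ _ : K ∈ T.cells, ∃ _ : i ∈ K, x ∈ convexHull ℝ (K : Set E) :=
    ⟨K, hK, hi, openCell_subset hx⟩
  rw [hat, dif_pos h]
  -- The definition of `hat` picks an arbitrary element containing the point; at an interior point
  -- of `K` the choice can only be `K`.
  have key : ∀ K' (hK' : K' ∈ T.cells) (hi' : i ∈ K'), x ∈ convexHull ℝ (K' : Set E) →
      (T.cellBasis hK').coord ⟨i, hi'⟩ x = (T.cellBasis hK).coord ⟨i, hi⟩ x := by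
    intro K' hK' hi' hx'
    obtain rfl := eq_of_mem_openCell hK hK' hx hx'
    rfl
  exact key _ _ _ h.choose_spec.choose_spec.choose_spec

theorem hat_eq_zero (hK : K ∈ T.cells) (hi : i ∉ K) (hx : x ∈ openCell K) : T.hat i x = 0 := by
  refine dif_neg ?_
  rintro ⟨K', hK', hi', hx'⟩
  obtain rfl := eq_of_mem_openCell hK hK' hx hx'
  exact hi hi'

theorem gradient_hat (hK : K ∈ T.cells) (hx : x ∈ openCell K) :
    ∇ (T.hat i) x = T.cellGrad K i := by
  have hnhds : openCell K ∈ 𝓝 x := isOpen_openCell.mem_nhds hx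
  by_cases hi : i ∈ K
  · have h1 : T.hat i =ᶠ[𝓝 x] fun y => (T.cellBasis hK).coord ⟨i, hi⟩ y := by
      filter_upwards [hnhds] with y hy using hat_eq_coord hK hi hy
    have h2 : (fun y => (T.cellBasis hK).coord ⟨i, hi⟩ y) = fun y =>
        (T.cellBasis hK).coord ⟨i, hi⟩ x + inner ℝ (T.cellGrad K i) (y - x) := by
      ext y
      rw [inner_cellGrad_sub hK hi]
      ring
    refine HasGradientAt.gradient ?_
    rw [hasGradientAt_iff_hasFDerivAt]
    refine HasFDerivAt.congr_of_eventuallyEq ?_ h1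
    rw [h2]
    refine HasFDerivAt.const_add _ ?_
    have h3 : HasFDerivAt (fun y => inner ℝ (T.cellGrad K i) y)
        (InnerProductSpace.toDual ℝ E (T.cellGrad K i)) x :=
      (InnerProductSpace.toDual ℝ E (T.cellGrad K i)).hasFDerivAt
    simpa only [inner_sub_right] using h3.sub_const _
  · rw [cellGrad_eq_zero hi]
    have h1 : T.hat i =ᶠ[𝓝 x] fun _ => 0 := by
      filter_upwards [hnhds] with y hy using hat_eq_zero hK hi hy
    rw [h1.gradient_eq]
    exact gradient_fun_const x 0

theorem coord_le_one (hK : K ∈ T.cells) (i : K) (hx : x ∈ convexHull ℝ (K : Set E)) :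
    (T.cellBasis hK).coord i x ≤ 1 := by
  have h := (mem_convexHull_iff hK).1 hx
  rw [← (T.cellBasis hK).sum_coord_apply_eq_one x]
  exact Finset.single_le_sum (fun j _ => h j) (Finset.mem_univ i)

/-- A barycentric coordinate varies by at most $1$ on the element, hence along the diameter $2r$ of
an inscribed ball in the direction of its gradient: $2r|\nabla\phi_i|\le1$. -/
theorem norm_cellGrad_mul_diam_le {σ : ℝ} (hT : T.ShapeRegular σ) (hK : K ∈ T.cells) :
    ‖T.cellGrad K i‖ * diam (convexHull ℝ (K : Set E)) ≤ σ := by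
  obtain ⟨c, r, hr, hball, hdiam⟩ := hT K hK
  have hσ : 0 ≤ σ := by
    have := diam_nonneg.trans hdiam
    exact nonneg_of_mul_nonneg_left this (by positivity)
  by_cases hi : i ∈ K
  swap
  · rw [cellGrad_eq_zero hi, norm_zero, zero_mul]
    exact hσ
  set g := T.cellGrad K i with hg
  rcases eq_or_ne g 0 with h0 | h0
  · rw [h0, norm_zero, zero_mul]
    exact hσ
  have hg0 : 0 < ‖g‖ := norm_pos_iff.2 h0
  set e := (r / ‖g‖) • g with he
  have hen : ‖e‖ = r := by
    rw [he, norm_smul, Real.norm_of_nonneg (by positivity), div_mul_cancel₀ _ hg0.ne']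
  have h1 : c + e ∈ convexHull ℝ (K : Set E) := hball (by simp [hen])
  have h2 : c - e ∈ convexHull ℝ (K : Set E) := hball (by simp [hen])
  have h3 := inner_cellGrad_sub hK hi (c + e) (c - e)
  rw [← hg, show c + e - (c - e) = (2 : ℝ) • e by rw [two_smul]; abel, he, smul_smul,
    inner_smul_right, real_inner_self_eq_norm_sq] at h3
  have h4 := coord_le_one hK ⟨i, hi⟩ h1
  have h5 := (mem_convexHull_iff hK).1 h2 ⟨i, hi⟩
  have h6 : 2 * (r / ‖g‖) * ‖g‖ ^ 2 = 2 * r * ‖g‖ := by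
    field_simp
  rw [h6, ← he] at h3
  have h7 : 2 * r * ‖g‖ ≤ 1 := by
    rw [h3]; linarith
  calc ‖g‖ * diam (convexHull ℝ (K : Set E)) ≤ ‖g‖ * (σ * (2 * r)) := by gcongr
    _ = σ * (2 * r * ‖g‖) := by ring
    _ ≤ σ * 1 := by gcongr
    _ = σ := mul_one σ

theorem sum_cellGrad (hK : K ∈ T.cells) : ∑ i ∈ K, T.cellGrad K i = 0 := by
  refine ext_inner_right ℝ fun v => ?_
  rw [sum_inner, inner_zero_left, ← Finset.sum_coe_sort]
  have h : ∀ k : K, inner ℝ (T.cellGrad K k) v =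
      (T.cellBasis hK).coord k v - (T.cellBasis hK).coord k 0 := fun k => by
    rw [← inner_cellGrad_sub hK k.2, sub_zero]
  simp only [h, Finset.sum_sub_distrib, AffineBasis.sum_coord_apply_eq_one, sub_self]

/-- Interpolation reproduces linear functions, because $\sum_k\lambda_k(y)\,x_k=y$ for the
barycentric coordinates. -/
theorem sum_inner_smul_cellGrad (hK : K ∈ T.cells) (a : E) :
    ∑ i ∈ K, inner ℝ a i • T.cellGrad K i = a := by
  refine ext_inner_right ℝ fun v => ?_
  rw [sum_inner, ← Finset.sum_coe_sort]
  have h : ∀ k : K, inner ℝ (inner ℝ a (k : E) • T.cellGrad K k) v =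
      inner ℝ a ((T.cellBasis hK).coord k v • (k : E)) -
        inner ℝ a ((T.cellBasis hK).coord k 0 • (k : E)) := fun k => by
    rw [real_inner_smul_left, real_inner_smul_right, real_inner_smul_right, ← sub_mul,
      ← inner_cellGrad_sub hK k.2, sub_zero, mul_comm]
  simp only [h, Finset.sum_sub_distrib, ← inner_sum]
  have h2 : ∀ y : E, ∑ k : K, (T.cellBasis hK).coord k y • (k : E) = y := fun y =>
    (T.cellBasis hK).linear_combination_coord_eq_self y
  rw [h2, h2, inner_zero_right, sub_zero]

theorem setIntegral_inner_gradient_hat (hK : K ∈ T.cells) :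
    ∫ x in convexHull ℝ (K : Set E), inner ℝ (∇ (T.hat i) x) (∇ (T.hat j) x) =
      volume.real (openCell K) * inner ℝ (T.cellGrad K i) (T.cellGrad K j) := by
  rw [← setIntegral_congr_set openCell_ae_eq,
    setIntegral_congr_fun (g := fun _ => inner ℝ (T.cellGrad K i) (T.cellGrad K j))
    isOpen_openCell.measurableSet fun x hx => by simp only [gradient_hat hK hx]]
  simp

theorem measure_openCell_lt_top : volume (openCell K) < ⊤ :=
  (measure_mono openCell_subset).trans_lt isCompact_convexHull_cell.measure_lt_top

/-- Off the two patches one of the gradients vanishes almost everywhere, so the integral may be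
taken over $\overline\Omega$ and cut into cells, where the integrand is constant. -/
theorem coeff_eq_sum (T : SimplicialMesh Ω) (i j : E) : T.coeff i j = ∑ K ∈ T.cells,
    volume.real (openCell K) * |inner ℝ (T.cellGrad K i) (T.cellGrad K j)| := by
  set f : E → ℝ := fun x => |inner ℝ (∇ (T.hat i) x) (∇ (T.hat j) x)| with hf
  have hfK : ∀ K ∈ T.cells, EqOn f (fun _ => |inner ℝ (T.cellGrad K i) (T.cellGrad K j)|)
      (openCell K) := fun K hK x hx => by
    simp only [hf, gradient_hat hK hx]
  have hsub : T.patch i ∩ T.patch j ⊆ closure Ω := by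
    rintro x ⟨hx, -⟩
    simp only [patch, mem_iUnion] at hx
    obtain ⟨K, hK, -, hxK⟩ := hx
    exact convexHull_subset_closure hK hxK
  have h1 : T.coeff i j = ∫ x in closure Ω, f x := by
    refine (setIntegral_eq_of_subset_of_ae_sdiff_eq_zero isClosed_closure.nullMeasurableSet
      hsub ?_).symm
    filter_upwards [T.ae_mem_openCell] with x hx hxd
    obtain ⟨K, hK, hxK⟩ := hx hxd.1
    refine (hfK K hK hxK).trans ?_
    by_cases hi : i ∈ K
    · by_cases hj : j ∈ K
      · refine absurd ⟨?_, ?_⟩ hxd.2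
        · exact mem_iUnion₂.2 ⟨K, hK, mem_iUnion.2 ⟨hi, openCell_subset hxK⟩⟩
        · exact mem_iUnion₂.2 ⟨K, hK, mem_iUnion.2 ⟨hj, openCell_subset hxK⟩⟩
      · simp [cellGrad_eq_zero hj]
    · simp [cellGrad_eq_zero hi]
  have h2 : (⋃ K ∈ T.cells, openCell K : Set E) =ᵐ[volume] closure Ω := by
    filter_upwards [T.ae_mem_openCell] with x hx
    refine propext ⟨fun h => ?_, fun h => ?_⟩
    · obtain ⟨K, hK, hxK⟩ := mem_iUnion₂.1 h
      exact convexHull_subset_closure hK (openCell_subset hxK)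
    · obtain ⟨K, hK, hxK⟩ := hx h
      exact mem_iUnion₂.2 ⟨K, hK, hxK⟩
  rw [h1, ← setIntegral_congr_set h2, integral_biUnion_finset _
    (fun K _ => isOpen_openCell.measurableSet) pairwiseDisjoint_openCell]
  · refine Finset.sum_congr rfl fun K hK => ?_
    rw [setIntegral_congr_fun isOpen_openCell.measurableSet (hfK K hK)]
    simp
  · intro K hK
    refine IntegrableOn.congr_fun ?_ (hfK K hK).symm isOpen_openCell.measurableSet
    exact integrableOn_const (by exact measure_openCell_lt_top.ne)

end SimplicialMesh

/-! ### Norms in $L^2$ and $L^\infty$, and their relation to the $H^2$ norm -/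

section LpNorm

variable {d : ℕ} {F : Type*} [NormedAddCommGroup F] {S : Set (EuclideanSpace ℝ (Fin d))}
  {f g : EuclideanSpace ℝ (Fin d) → F}

local notation "E" => EuclideanSpace ℝ (Fin d)

theorem lpNormOn_nonneg (S : Set E) (p : ℝ≥0∞) (f : E → F) : 0 ≤ lpNormOn S p f :=
  ENNReal.toReal_nonneg

theorem eLpNorm_two_sq {α : Type*} [MeasurableSpace α] (μ : Measure α) (f : α → F) :
    eLpNorm f 2 μ ^ 2 = ∫⁻ x, ‖f x‖ₑ ^ 2 ∂μ := by
  have h := eLpNorm_nnreal_pow_eq_lintegral (μ := μ) (f := f) (p := 2) (by norm_num)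
  simpa using h

theorem ofReal_lpNormOn {p : ℝ≥0∞} (hf : MemLp f p (volume.restrict S)) :
    ENNReal.ofReal (lpNormOn S p f) = eLpNorm f p (volume.restrict S) :=
  ENNReal.ofReal_toReal hf.2.ne

theorem lpNormOn_add_le (hf : MemLp f 2 (volume.restrict S)) (hg : MemLp g 2 (volume.restrict S)) :
    lpNormOn S 2 (f + g) ≤ lpNormOn S 2 f + lpNormOn S 2 g := by
  rw [lpNormOn, lpNormOn, lpNormOn, ← ENNReal.toReal_add hf.2.ne hg.2.ne]
  exact ENNReal.toReal_mono (ENNReal.add_lt_top.2 ⟨hf.2, hg.2⟩).ne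
    (eLpNorm_add_le hf.1 hg.1 one_le_two)

theorem lpNormOn_sq (hf : MemLp f 2 (volume.restrict S)) :
    lpNormOn S 2 f ^ 2 = ∫ x in S, ‖f x‖ ^ 2 := by
  have hm : AEStronglyMeasurable (fun x => ‖f x‖ ^ 2) (volume.restrict S) := hf.1.norm.pow 2
  rw [lpNormOn, ← ENNReal.toReal_pow, eLpNorm_two_sq, integral_eq_lintegral_of_nonneg_ae
    (Eventually.of_forall fun x => by positivity) hm]
  congr 1
  refine lintegral_congr fun x => ?_
  rw [ENNReal.ofReal_pow (norm_nonneg _), ofReal_norm]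

theorem lpNormOn_const (c : F) : lpNormOn S 2 (fun _ => c) = ‖c‖ * Real.sqrt (volume.real S) := by
  rw [lpNormOn, eLpNorm_const' _ (by norm_num) (by norm_num), ENNReal.toReal_mul, toReal_enorm]
  simp [← ENNReal.toReal_rpow, Real.sqrt_eq_rpow, Measure.real]

theorem ae_norm_le_lpNormOn_top (hf : MemLp f ⊤ (volume.restrict S)) :
    ∀ᵐ z ∂volume.restrict S, ‖f z‖ ≤ lpNormOn S ⊤ f := by
  have hfin := hf.2
  rw [eLpNorm_exponent_top] at hfin
  filter_upwards [ae_le_eLpNormEssSup (f := f) (μ := volume.restrict S)] with z hz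
  rw [lpNormOn, eLpNorm_exponent_top, ← toReal_enorm]
  exact ENNReal.toReal_mono hfin.ne hz

theorem abs_setIntegral_mul_inner_le {F : Type*} [NormedAddCommGroup F] [InnerProductSpace ℝ F]
    {f g : E → F} {w : E → ℝ} {M : ℝ} (hM : 0 ≤ M)
    (hw : ∀ᵐ x ∂volume.restrict S, ‖w x‖ ≤ M) (hf : MemLp f 2 (volume.restrict S))
    (hg : MemLp g 2 (volume.restrict S)) :
    |∫ x in S, w x * inner ℝ (f x) (g x)| ≤ M * (lpNormOn S 2 f * lpNormOn S 2 g) := by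
  have h1 : ‖∫ x in S, w x * inner ℝ (f x) (g x)‖ₑ ≤
      ENNReal.ofReal M * (eLpNorm f 2 (volume.restrict S) * eLpNorm g 2 (volume.restrict S)) := by
    refine (enorm_integral_le_lintegral_enorm _).trans ?_
    calc ∫⁻ x in S, ‖w x * inner ℝ (f x) (g x)‖ₑ
        ≤ ∫⁻ x in S, ENNReal.ofReal M * (‖f x‖ₑ * ‖g x‖ₑ) := by
          refine lintegral_mono_ae ?_
          filter_upwards [hw] with x hx
          rw [← ofReal_norm, ← ofReal_norm, ← ofReal_norm, ← ENNReal.ofReal_mul (norm_nonneg _),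
            ← ENNReal.ofReal_mul hM, norm_mul]
          exact ENNReal.ofReal_le_ofReal
            (mul_le_mul hx (norm_inner_le_norm _ _) (norm_nonneg _) hM)
      _ = ENNReal.ofReal M * ∫⁻ x in S, ‖f x‖ₑ * ‖g x‖ₑ :=
          lintegral_const_mul' _ _ ENNReal.ofReal_ne_top
      _ ≤ _ := by
          refine mul_le_mul_right ?_ _
          rw [← ENNReal.pow_le_pow_left_iff (two_ne_zero), mul_pow, eLpNorm_two_sq, eLpNorm_two_sq]
          exact lintegral_mul_sq_le _ hf.1.enorm hg.1.enorm
  rw [← ofReal_lpNormOn hf, ← ofReal_lpNormOn hg, ← ENNReal.ofReal_mul (lpNormOn_nonneg _ _ _),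
    ← ENNReal.ofReal_mul hM, Real.enorm_eq_ofReal_abs, ENNReal.ofReal_le_ofReal_iff] at h1
  · exact h1
  · have := lpNormOn_nonneg S 2 f
    have := lpNormOn_nonneg S 2 g
    positivity

theorem integrable_norm_sq {α : Type*} [MeasurableSpace α] {μ : Measure α} {f : α → F}
    (hf : MemLp f 2 μ) : Integrable (fun x => ‖f x‖ ^ 2) μ :=
  MemLp.integrable_norm_pow (p := 2) (by exact_mod_cast hf) two_ne_zero

theorem integrable_mul_inner {F : Type*} [NormedAddCommGroup F] [InnerProductSpace ℝ F]
    {f g : E → F} {w : E → ℝ} (hw : MemLp w ⊤ (volume.restrict S))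
    (hf : MemLp f 2 (volume.restrict S)) (hg : MemLp g 2 (volume.restrict S)) :
    IntegrableOn (fun x => w x * inner ℝ (f x) (g x)) S := by
  refine Integrable.mono' (((integrable_norm_sq hf).add (integrable_norm_sq hg)).const_mul (lpNormOn S ⊤ w)) (hw.1.mul (hf.1.inner hg.1)) ?_
  filter_upwards [ae_norm_le_lpNormOn_top hw] with x hx
  rw [norm_mul]
  refine mul_le_mul hx ?_ (norm_nonneg _) (lpNormOn_nonneg _ _ _)
  refine (norm_inner_le_norm _ _).trans ?_
  simp only [Pi.add_apply]
  nlinarith [sq_nonneg (‖f x‖ - ‖g x‖), sq_nonneg (‖f x‖), sq_nonneg (‖g x‖)]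

theorem lpNormOn_weakGrad_sq {Ω : Set E} {u : E → ℝ} (hu : MemH2 Ω u) :
    lpNormOn Ω 2 (weakGrad Ω u) ^ 2 = ∑ i, lpNormOn Ω 2 (weakPartial Ω i u) ^ 2 := by
  have he : ∀ i, lpNormOn Ω 2 (weakPartial Ω i u) ^ 2 = ∫ x in Ω, ‖weakPartial Ω i u x‖ ^ 2 :=
    fun i => lpNormOn_sq (hu.2.1 i).2
  simp only [he]
  rw [lpNormOn_sq (memLp_weakGrad fun i => (hu.2.1 i).2),
    ← integral_finsetSum _ fun i _ => integrable_norm_sq (hu.2.1 i).2]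
  refine integral_congr_ae (Eventually.of_forall fun x => ?_)
  simp [EuclideanSpace.norm_sq_eq, weakGrad]

theorem lpNormOn_hessNorm_sq {Ω : Set E} {u : E → ℝ} (hu : MemH2 Ω u) :
    lpNormOn Ω 2 (hessNorm Ω u) ^ 2 =
      ∑ i, ∑ j, lpNormOn Ω 2 (weakPartial Ω j (weakPartial Ω i u)) ^ 2 := by
  obtain ⟨H, hH⟩ : ∃ H : Fin d → Fin d → E → ℝ, H = fun i j => weakPartial Ω j (weakPartial Ω i u) :=
    ⟨_, rfl⟩
  have hHm : ∀ i j, MemLp (H i j) 2 (volume.restrict Ω) := fun i j => by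
    rw [hH]; exact (hu.2.2 i j).2
  have hHn : ∀ x, ‖hessNorm Ω u x‖ ^ 2 = ∑ i, ∑ j, ‖H i j x‖ ^ 2 := fun x => by
    simp only [hessNorm, Real.norm_eq_abs, sq_abs, hH]
    exact Real.sq_sqrt (by positivity)
  have hgoal : ∑ i, ∑ j, lpNormOn Ω 2 (H i j) ^ 2 = ∫ x in Ω, ∑ i, ∑ j, ‖H i j x‖ ^ 2 := by
    rw [integral_finsetSum _ fun i _ => integrable_finsetSum _ fun j _ =>
      integrable_norm_sq (hHm i j)]
    refine Finset.sum_congr rfl fun i _ => ?_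
    rw [integral_finsetSum _ fun j _ => integrable_norm_sq (hHm i j)]
    exact Finset.sum_congr rfl fun j _ => lpNormOn_sq (hHm i j)
  have h := lpNormOn_sq (memLp_hessNorm hu)
  simp only [hHn] at h
  rw [h, ← hgoal, hH]

theorem lpNormOn_weakGrad_sq_add_hessNorm_sq {Ω : Set E} {u : E → ℝ} (hu : MemH2 Ω u) :
    lpNormOn Ω 2 (weakGrad Ω u) ^ 2 + lpNormOn Ω 2 (hessNorm Ω u) ^ 2 ≤ normH2 Ω u ^ 2 := by
  rw [normH2, Real.sq_sqrt (by positivity), lpNormOn_weakGrad_sq hu, lpNormOn_hessNorm_sq hu]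
  linarith [sq_nonneg (lpNormOn Ω 2 u)]

theorem normH2_nonneg {Ω : Set E} {u : E → ℝ} : 0 ≤ normH2 Ω u := Real.sqrt_nonneg _

end LpNorm

/-! ### Interpolation error on one element -/

namespace SimplicialMesh

variable {d : ℕ} {Ω : Set (EuclideanSpace ℝ (Fin d))} {T : SimplicialMesh Ω}
  {K : Finset (EuclideanSpace ℝ (Fin d))} {u u' : EuclideanSpace ℝ (Fin d) → ℝ}
  {i j : EuclideanSpace ℝ (Fin d)}

local notation "E" => EuclideanSpace ℝ (Fin d)

/-- The diameter of the simplex with vertices `K`. -/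
def cellDiam (K : Finset (EuclideanSpace ℝ (Fin d))) : ℝ :=
  diam (convexHull ℝ (K : Set (EuclideanSpace ℝ (Fin d))))

theorem cellDiam_nonneg : 0 ≤ cellDiam K := diam_nonneg

theorem norm_sub_le_cellDiam {a b : E} (ha : a ∈ convexHull ℝ (K : Set E))
    (hb : b ∈ convexHull ℝ (K : Set E)) : ‖a - b‖ ≤ cellDiam K := by
  rw [← dist_eq_norm]
  exact dist_le_diam_of_mem isCompact_convexHull_cell.isBounded ha hb

/-- The gradient on `K` of the Lagrange interpolant with nodal values `U`. -/
def interpGrad (T : SimplicialMesh Ω) (U : E → ℝ) (K : Finset E) : E :=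
  ∑ i ∈ K, U i • T.cellGrad K i

theorem sub_eq_inner_interpGrad (hK : K ∈ T.cells) (U : E → ℝ) (hi : i ∈ K) (hj : j ∈ K) :
    U i - U j = inner ℝ (T.interpGrad U K) (i - j) := by
  classical
  have h : ∀ a (ha : a ∈ K),
      ∑ k : K, U k * (T.cellBasis hK).coord k a = U a := by
    intro a ha
    have : ∀ k : K, (T.cellBasis hK).coord k a = if k = ⟨a, ha⟩ then 1 else 0 := fun k => by
      have := (T.cellBasis hK).coord_apply k ⟨a, ha⟩
      rwa [cellBasis_apply] at this
    simp [this]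
  rw [interpGrad, sum_inner, ← Finset.sum_coe_sort]
  have h2 : ∀ k : K, inner ℝ (U k • T.cellGrad K k) (i - j) =
      U k * (T.cellBasis hK).coord k i - U k * (T.cellBasis hK).coord k j := fun k => by
    rw [real_inner_smul_left, inner_cellGrad_sub hK k.2, mul_sub]
  simp only [h2, Finset.sum_sub_distrib]
  rw [h i hi, h j hj]

/-- Subtract from the nodal values those of the affine Taylor polynomial centred at $y$: the
interpolation operator reproduces it, so only remainders survive. The identity is exact and local.
-/
theorem interpGrad_sub_weakGrad (hK : K ∈ T.cells) (U : E → ℝ) (y : E) :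
    T.interpGrad U K - weakGrad Ω u y =
      ∑ i ∈ K, taylorRem Ω u (U i) i y • T.cellGrad K i := by
  have h1 : ∀ i ∈ K, taylorRem Ω u (U i) i y • T.cellGrad K i = U i • T.cellGrad K i -
      (u y - inner ℝ (weakGrad Ω u y) y) • T.cellGrad K i -
      inner ℝ (weakGrad Ω u y) i • T.cellGrad K i := by
    intro i _
    rw [taylorRem, inner_sub_right, ← sub_smul, ← sub_smul]
    congr 1
    ring
  rw [Finset.sum_congr rfl h1, Finset.sum_sub_distrib, Finset.sum_sub_distrib, ← Finset.smul_sum,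
    sum_cellGrad hK, sum_inner_smul_cellGrad hK, smul_zero, sub_zero, interpGrad]

/-- The interpolation error estimate on one element. -/
theorem lpNormOn_interpGrad_sub_le {σ : ℝ} (hT : T.ShapeRegular σ)
    (hΩ : IsLipschitzDomain Ω) (hu : MemH2 Ω u) (hK : K ∈ T.cells)
    (hu' : ∀ i ∈ K, ∫⁻ y in openCell K, ‖taylorRem Ω u (u' i) i y‖ₑ ^ 2 ≤
        ENNReal.ofReal (4 * cellDiam K ^ 4) * ∫⁻ z in openCell K, ‖hessNorm Ω u z‖ₑ ^ 2) :
    lpNormOn (openCell K) 2 (fun y => T.interpGrad u' K - weakGrad Ω u y) ≤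
      2 * (d + 1) * σ * cellDiam K * lpNormOn (openCell K) 2 (hessNorm Ω u) := by
  have hr : volume.restrict (openCell K) ≤ volume.restrict Ω :=
    Measure.restrict_mono (openCell_subset_domain hΩ hK) le_rfl
  set μ := volume.restrict (openCell K) with hμ
  set h := cellDiam K with hh
  have hh0 : 0 ≤ h := cellDiam_nonneg
  have hH : MemLp (hessNorm Ω u) 2 μ := (memLp_hessNorm hu).mono_measure hr
  have hT1 : ∀ i ∈ K, eLpNorm (fun y => taylorRem Ω u (u' i) i y) 2 μ ≤
      ENNReal.ofReal (2 * h ^ 2) * eLpNorm (hessNorm Ω u) 2 μ := by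
    intro i hi
    rw [← ENNReal.pow_le_pow_left_iff (two_ne_zero), mul_pow, eLpNorm_two_sq, eLpNorm_two_sq,
      ← ENNReal.ofReal_pow (by positivity)]
    convert hu' i hi using 3
    ring
  have hm : ∀ i, AEStronglyMeasurable (fun y => taylorRem Ω u (u' i) i y) μ := fun i =>
    ((aemeasurable_taylorRem hu _ _).mono_measure hr).aestronglyMeasurable
  -- The remainder is of order $h^2$ and $|\nabla\phi_i|\,h\le\sigma$, so one power of $h$ is left.
  have hT2 : ∀ i ∈ K, eLpNorm (fun y => taylorRem Ω u (u' i) i y • T.cellGrad K i) 2 μ ≤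
      ENNReal.ofReal (2 * σ * h) * eLpNorm (hessNorm Ω u) 2 μ := by
    intro i hi
    refine (eLpNorm_le_mul_eLpNorm_of_ae_le_mul (c := ‖T.cellGrad K i‖)
      (g := fun y => taylorRem Ω u (u' i) i y)
      (Eventually.of_forall fun y => by rw [norm_smul, mul_comm]) 2).trans ?_
    refine (mul_le_mul_right (hT1 i hi) _).trans ?_
    rw [← mul_assoc, ← ENNReal.ofReal_mul (norm_nonneg _)]
    refine mul_le_mul_left (ENNReal.ofReal_le_ofReal ?_) _
    have := mul_le_mul_of_nonneg_right (norm_cellGrad_mul_diam_le (i := i) hT hK) hh0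
    rw [← cellDiam, ← hh] at this
    nlinarith
  have hsum : eLpNorm (fun y => T.interpGrad u' K - weakGrad Ω u y) 2 μ ≤
      (d + 1 : ℕ) * (ENNReal.ofReal (2 * σ * h) * eLpNorm (hessNorm Ω u) 2 μ) := by
    have e : (fun y => T.interpGrad u' K - weakGrad Ω u y) =
        ∑ i ∈ K, fun y => taylorRem Ω u (u' i) i y • T.cellGrad K i := by
      ext1 y
      rw [interpGrad_sub_weakGrad hK, Finset.sum_apply]
    rw [e]
    refine (eLpNorm_sum_le (fun i _ => (hm i).smul_const _) one_le_two).trans ?_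
    refine (Finset.sum_le_sum hT2).trans (le_of_eq ?_)
    rw [Finset.sum_const, (mem_cells.1 hK).2, nsmul_eq_mul]
  have hσh : 0 ≤ σ * h := by
    obtain ⟨i, hi⟩ : K.Nonempty := Finset.card_pos.1 (by rw [(mem_cells.1 hK).2]; omega)
    exact mul_nonneg ((mul_nonneg (norm_nonneg _) diam_nonneg).trans
      (norm_cellGrad_mul_diam_le (i := i) hT hK)) hh0
  rw [← ofReal_lpNormOn hH, ← ENNReal.ofReal_mul (by linarith), ← ENNReal.ofReal_natCast,
    ← ENNReal.ofReal_mul (by positivity)] at hsum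
  have := ENNReal.toReal_mono ENNReal.ofReal_ne_top hsum
  rw [ENNReal.toReal_ofReal] at this
  · refine this.trans (le_of_eq ?_)
    push_cast
    ring
  · have := lpNormOn_nonneg (openCell K) 2 (hessNorm Ω u)
    rw [mul_assoc 2 σ h]
    positivity

end SimplicialMesh

/-! ### Discrete form, quadrature error and consistency error on one element -/

/-- Average the sum with its copy under the exchange of `i` and `j`. Only differences of nodal
values remain, and these are controlled by gradients. -/
theorem sum_sum_mul_mul_sub {α : Type*} (s : Finset α) {b : α → α → ℝ}
    (hb : ∀ i ∈ s, ∀ j ∈ s, b i j = b j i) (U V : α → ℝ) :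
    ∑ i ∈ s, ∑ j ∈ s, b i j * (U i * (V j - V i)) =
      -(1 / 2) * ∑ i ∈ s, ∑ j ∈ s, b i j * ((U i - U j) * (V i - V j)) := by
  have h1 : ∑ i ∈ s, ∑ j ∈ s, b i j * (U i * (V j - V i)) =
      ∑ i ∈ s, ∑ j ∈ s, b i j * (U j * (V i - V j)) := by
    rw [Finset.sum_comm]
    exact Finset.sum_congr rfl fun i hi => Finset.sum_congr rfl fun j hj => by rw [hb j hj i hi]
  have h2 : ∑ i ∈ s, ∑ j ∈ s, b i j * (U i * (V j - V i)) +
      ∑ i ∈ s, ∑ j ∈ s, b i j * (U j * (V i - V j)) =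
      - ∑ i ∈ s, ∑ j ∈ s, b i j * ((U i - U j) * (V i - V j)) := by
    simp only [← Finset.sum_add_distrib, ← Finset.sum_neg_distrib]
    exact Finset.sum_congr rfl fun i _ => Finset.sum_congr rfl fun j _ => by ring
  linarith

namespace SimplicialMesh

variable {d : ℕ} {Ω : Set (EuclideanSpace ℝ (Fin d))} {T : SimplicialMesh Ω}
  {K : Finset (EuclideanSpace ℝ (Fin d))} {u v w w' U V : EuclideanSpace ℝ (Fin d) → ℝ}
  {i j : EuclideanSpace ℝ (Fin d)}
  {W : EuclideanSpace ℝ (Fin d) → EuclideanSpace ℝ (Fin d) → ℝ}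

local notation "E" => EuclideanSpace ℝ (Fin d)

theorem subset_nodes (hK : K ∈ T.cells) : K ⊆ T.nodes := fun _ hi =>
  Finset.mem_biUnion.2 ⟨K, hK, hi⟩

/-- The matrix of the Dirichlet form of the element `K`, per unit of volume. -/
def stiffness (T : SimplicialMesh Ω) (K : Finset E) (i j : E) : ℝ :=
  inner ℝ (T.cellGrad K i) (T.cellGrad K j)

theorem stiffness_comm : T.stiffness K i j = T.stiffness K j i := real_inner_comm _ _

/-- The rows of the stiffness matrix sum to zero because $\sum_j\nabla\phi_j=0$, so $V_j$ may be
replaced by $V_j-V_i$. -/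
theorem inner_interpGrad (hK : K ∈ T.cells) (U V : E → ℝ) :
    inner ℝ (T.interpGrad U K) (T.interpGrad V K) =
      -(1 / 2) * ∑ i ∈ K, ∑ j ∈ K, T.stiffness K i j * ((U i - U j) * (V i - V j)) := by
  rw [← sum_sum_mul_mul_sub K (fun i _ j _ => stiffness_comm), interpGrad, sum_inner]
  refine Finset.sum_congr rfl fun i _ => ?_
  have h0 : ∑ j ∈ K, T.stiffness K i j = 0 := by
    simp only [stiffness]
    rw [← inner_sum, sum_cellGrad hK, inner_zero_right]
  have h1 : ∑ j ∈ K, T.stiffness K i j * (U i * (V j - V i)) =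
      U i * ∑ j ∈ K, V j * T.stiffness K i j - U i * V i * ∑ j ∈ K, T.stiffness K i j := by
    rw [Finset.mul_sum, Finset.mul_sum, ← Finset.sum_sub_distrib]
    exact Finset.sum_congr rfl fun j _ => by ring
  rw [h1, h0, mul_zero, sub_zero, interpGrad, real_inner_smul_left, inner_sum]
  simp only [real_inner_smul_right, stiffness]

theorem volume_mul_abs_stiffness (hT : T.IsAcute) (hK : K ∈ T.cells) (hi : i ∈ T.nodes)
    (hj : j ∈ T.nodes) (hij : i ≠ j) :
    volume.real (openCell K) * |T.stiffness K i j| =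
      -(volume.real (openCell K) * T.stiffness K i j) := by
  have h := hT K hK i hi j hj hij
  rw [setIntegral_inner_gradient_hat hK] at h
  have h' := abs_of_nonpos h
  rwa [abs_mul, abs_of_nonneg measureReal_nonneg] at h'

/-- The angle condition acts element by element, so the absolute values only reverse the sign of
each off-diagonal contribution and the weights stay attached to the cells. The diagonal drops out
through $V_i-V_i=0$. -/
theorem neg_sum_coeff_eq (hT : T.IsAcute) (U V : E → ℝ) (W : E → E → ℝ) :
    -(∑ i ∈ T.nodes, ∑ j ∈ T.nodes, U i * T.coeff i j * W i j * (V j - V i)) =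
      ∑ K ∈ T.cells, volume.real (openCell K) *
        ∑ i ∈ K, ∑ j ∈ K, T.stiffness K i j * W i j * (U i * (V j - V i)) := by
  have h1 : ∀ i ∈ T.nodes, ∀ j ∈ T.nodes, U i * T.coeff i j * W i j * (V j - V i) =
      -∑ K ∈ T.cells, volume.real (openCell K) *
        (T.stiffness K i j * W i j * (U i * (V j - V i))) := by
    intro i hi j hj
    rcases eq_or_ne i j with rfl | hij
    · simp
    have h2 : T.coeff i j = -∑ K ∈ T.cells, volume.real (openCell K) * T.stiffness K i j := by
      rw [coeff_eq_sum, ← Finset.sum_neg_distrib]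
      exact Finset.sum_congr rfl fun K hK => volume_mul_abs_stiffness hT hK hi hj hij
    rw [h2, mul_neg, neg_mul, neg_mul, Finset.mul_sum, Finset.sum_mul, Finset.sum_mul]
    congr 1
    exact Finset.sum_congr rfl fun K _ => by ring
  rw [Finset.sum_congr rfl fun i hi => Finset.sum_congr rfl (h1 i hi)]
  simp only [Finset.sum_neg_distrib, neg_neg]
  have h3 : ∀ i ∈ T.nodes, ∑ j ∈ T.nodes, ∑ K ∈ T.cells, volume.real (openCell K) *
        (T.stiffness K i j * W i j * (U i * (V j - V i))) =
      ∑ K ∈ T.cells, ∑ j ∈ T.nodes, volume.real (openCell K) *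
        (T.stiffness K i j * W i j * (U i * (V j - V i))) := fun i _ => Finset.sum_comm
  rw [Finset.sum_congr rfl h3, Finset.sum_comm]
  refine Finset.sum_congr rfl fun K hK => ?_
  simp only [← Finset.mul_sum]
  congr 1
  have h4 : ∀ i j, (i ∉ K ∨ j ∉ K) → T.stiffness K i j = 0 := by
    rintro i j (h | h) <;> simp [stiffness, cellGrad_eq_zero h]
  rw [← Finset.sum_subset (subset_nodes hK)]
  · refine Finset.sum_congr rfl fun i _ => (Finset.sum_subset (subset_nodes hK) ?_).symm
    intro j _ hj
    rw [h4 i j (Or.inr hj), zero_mul, zero_mul]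
  · intro i _ hi
    refine Finset.sum_eq_zero fun j _ => ?_
    rw [h4 i j (Or.inl hi), zero_mul, zero_mul]

/-- Each nodal difference is at most the interpolant's gradient times the diameter, and the two
diameters are absorbed by the two basis gradients. -/
theorem abs_stiffness_mul_le {σ : ℝ} (hT : T.ShapeRegular σ) (hK : K ∈ T.cells) (hi : i ∈ K)
    (hj : j ∈ K) (U V : E → ℝ) :
    |T.stiffness K i j * ((U i - U j) * (V i - V j))| ≤
      σ ^ 2 * (‖T.interpGrad U K‖ * ‖T.interpGrad V K‖) := by
  have hij : ‖i - j‖ ≤ cellDiam K :=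
    norm_sub_le_cellDiam (subset_convexHull ℝ _ hi) (subset_convexHull ℝ _ hj)
  have h1 : ∀ X : E → ℝ, |X i - X j| ≤ ‖T.interpGrad X K‖ * cellDiam K := fun X => by
    rw [sub_eq_inner_interpGrad hK X hi hj]
    exact (abs_real_inner_le_norm _ _).trans (by gcongr)
  have h2 : |T.stiffness K i j| ≤ ‖T.cellGrad K i‖ * ‖T.cellGrad K j‖ := abs_real_inner_le_norm _ _
  have h3 := norm_cellGrad_mul_diam_le (i := i) hT hK
  have h4 := norm_cellGrad_mul_diam_le (i := j) hT hK
  have h5 : 0 ≤ cellDiam K := cellDiam_nonneg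
  rw [abs_mul, abs_mul]
  calc |T.stiffness K i j| * (|U i - U j| * |V i - V j|) ≤
      (‖T.cellGrad K i‖ * ‖T.cellGrad K j‖) *
        ((‖T.interpGrad U K‖ * cellDiam K) * (‖T.interpGrad V K‖ * cellDiam K)) := by
        gcongr
        · exact h1 U
        · exact h1 V
    _ = ((‖T.cellGrad K i‖ * cellDiam K) * (‖T.cellGrad K j‖ * cellDiam K)) *
        (‖T.interpGrad U K‖ * ‖T.interpGrad V K‖) := by ring
    _ ≤ σ * σ * (‖T.interpGrad U K‖ * ‖T.interpGrad V K‖) := by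
        have h6 : 0 ≤ σ := (mul_nonneg (norm_nonneg _) h5).trans h3
        gcongr
        · exact h3
        · exact h4
    _ = _ := by ring

/-- The quadrature error on one element. -/
theorem abs_setIntegral_mul_inner_interpGrad_sub_le {σ M : ℝ} (hT : T.ShapeRegular σ)
    (hK : K ∈ T.cells) (hM : 0 ≤ M) (hw : IntegrableOn w (openCell K))
    (hww' : ∀ᵐ x ∂volume.restrict (openCell K), w' x = w x)
    (hlip : ∀ x ∈ convexHull ℝ (K : Set E), ∀ y ∈ convexHull ℝ (K : Set E),
      |w' x - w' y| ≤ M * ‖x - y‖)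
    (hW : ∀ i ∈ K, ∀ j ∈ K, i ≠ j → W i j = W j i ∧ W i j ∈ w' '' segment ℝ i j) :
    |(∫ x in openCell K, w x * inner ℝ (T.interpGrad U K) (T.interpGrad V K)) -
        volume.real (openCell K) *
          ∑ i ∈ K, ∑ j ∈ K, T.stiffness K i j * W i j * (U i * (V j - V i))| ≤
      (d + 1) ^ 2 * σ ^ 2 * (M * cellDiam K) *
        (volume.real (openCell K) * (‖T.interpGrad U K‖ * ‖T.interpGrad V K‖)) := by
  set m := volume.real (openCell K) with hm
  have hm0 : 0 ≤ m := measureReal_nonneg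
  set I := ∫ x in openCell K, w x with hI
  have hquad : ∀ i ∈ K, ∀ j ∈ K, i ≠ j → |I - m * W i j| ≤ M * cellDiam K * m := by
    intro i hi j hj hij
    obtain ⟨p, hp, hpW⟩ := (hW i hi j hj hij).2
    have hpK : p ∈ convexHull ℝ (K : Set E) := segment_subset_convexHull hi hj hp
    have h1 : I - m * W i j = ∫ x in openCell K, (w x - W i j) := by
      rw [integral_sub hw (integrableOn_const measure_openCell_lt_top.ne)]
      simp [hm, hI]
    have h2 := norm_setIntegral_le_of_norm_le_const_ae' (C := M * cellDiam K)
      (f := fun x => w x - W i j) (measure_openCell_lt_top (K := K)) (by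
        filter_upwards [(ae_restrict_iff' isOpen_openCell.measurableSet).1 hww'] with x hx hxK
        rw [← hx hxK, ← hpW]
        refine (hlip x (openCell_subset hxK) p hpK).trans ?_
        exact mul_le_mul_of_nonneg_left (norm_sub_le_cellDiam (openCell_subset hxK) hpK) hM)
    rwa [← h1] at h2
  have hWs : ∀ i ∈ K, ∀ j ∈ K, T.stiffness K i j * W i j = T.stiffness K j i * W j i := by
    intro i hi j hj
    rcases eq_or_ne i j with rfl | hij
    · rfl
    · rw [stiffness_comm, (hW i hi j hj hij).1]
  -- Both terms take the same symmetrized form, with weights $\int_Kw$ and $|K|\tilde W^{ij}$. The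
  -- error is thus a combination of the one-point quadrature errors of `hquad`.
  have hdiff : (∫ x in openCell K, w x * inner ℝ (T.interpGrad U K) (T.interpGrad V K)) -
      m * ∑ i ∈ K, ∑ j ∈ K, T.stiffness K i j * W i j * (U i * (V j - V i)) =
      -(1 / 2) * ∑ i ∈ K, ∑ j ∈ K,
        (I - m * W i j) * (T.stiffness K i j * ((U i - U j) * (V i - V j))) := by
    rw [integral_mul_const, inner_interpGrad hK, sum_sum_mul_mul_sub K hWs, ← hI, mul_left_comm,
      mul_left_comm m, ← mul_sub, Finset.mul_sum, Finset.mul_sum, ← Finset.sum_sub_distrib]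
    congr 1
    refine Finset.sum_congr rfl fun i _ => ?_
    rw [Finset.mul_sum, Finset.mul_sum, ← Finset.sum_sub_distrib]
    exact Finset.sum_congr rfl fun j _ => by ring
  have hd0 : 0 ≤ cellDiam K := cellDiam_nonneg
  set B := M * cellDiam K * m * (σ ^ 2 * (‖T.interpGrad U K‖ * ‖T.interpGrad V K‖)) with hB
  have hB0 : 0 ≤ B := by positivity
  have hterm : ∀ i ∈ K, ∀ j ∈ K,
      |(I - m * W i j) * (T.stiffness K i j * ((U i - U j) * (V i - V j)))| ≤ B := by
    intro i hi j hj
    -- Nothing is known about `W i i`, but the factor $U_i-U_i$ removes it.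
    rcases eq_or_ne i j with rfl | hij
    · simpa using hB0
    · rw [abs_mul]
      exact mul_le_mul (hquad i hi j hj hij) (abs_stiffness_mul_le hT hK hi hj U V)
        (abs_nonneg _) (by positivity)
  have hsum : |∑ i ∈ K, ∑ j ∈ K,
      (I - m * W i j) * (T.stiffness K i j * ((U i - U j) * (V i - V j)))| ≤ (d + 1) ^ 2 * B := by
    have h1 := fun i hi => (Finset.abs_sum_le_sum_abs _ _).trans (Finset.sum_le_sum (hterm i hi))
    refine (Finset.abs_sum_le_sum_abs _ _).trans ((Finset.sum_le_sum h1).trans (le_of_eq ?_))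
    simp only [Finset.sum_const, (mem_cells.1 hK).2, nsmul_eq_mul]
    push_cast
    ring
  rw [hdiff, abs_mul]
  have h12 : |(-(1 / 2) : ℝ)| = 1 / 2 := by norm_num
  rw [h12]
  have hX : 0 ≤ (d + 1 : ℝ) ^ 2 * B := by positivity
  calc _ ≤ 1 / 2 * ((d + 1) ^ 2 * B) := by gcongr
    _ ≤ (d + 1) ^ 2 * B := by linarith
    _ = _ := by rw [hB]; ring

/-- The interpolants' gradients are bounded by $a+C_1hq\le(1+C_1D)(a+q)$, with $h\le D$. This
absorbs the higher powers of $h$ into the constant and leaves one factor $h$. -/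
theorem cell_constant_le {M₀ M₁ h C₁ C₂ D eu ev gu gv au av qu qv : ℝ}
    (hM₀ : 0 ≤ M₀) (hM₁ : 0 ≤ M₁) (hh : 0 ≤ h) (hhD : h ≤ D) (hC₁ : 0 ≤ C₁) (hC₂ : 0 ≤ C₂)
    (hau : 0 ≤ au) (hav : 0 ≤ av) (hqu : 0 ≤ qu) (hqv : 0 ≤ qv) (hgv0 : 0 ≤ gv)
    (hev0 : 0 ≤ ev)
    (heu : eu ≤ C₁ * h * qu) (hev : ev ≤ C₁ * h * qv) (hgu : gu ≤ au + eu) (hgv : gv ≤ av + ev) :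
    M₀ * (eu * av) + M₀ * (gu * ev) + C₂ * (M₁ * h) * (gu * gv) ≤
      (C₁ + (1 + C₁ * D) * C₁ + C₂ * (1 + C₁ * D) ^ 2) * h * (M₀ + M₁) *
        ((au + qu) * (av + qv)) := by
  have hD : 0 ≤ D := hh.trans hhD
  have bound : ∀ a q e g : ℝ, 0 ≤ a → 0 ≤ q → e ≤ C₁ * h * q → g ≤ a + e →
      e ≤ C₁ * h * (a + q) ∧ g ≤ (1 + C₁ * D) * (a + q) := by
    intro a q e g ha hq he hg
    have h1 : C₁ * h * q ≤ C₁ * h * (a + q) := by gcongr; linarith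
    have h2 : C₁ * h * q ≤ C₁ * D * q := by gcongr
    have h3 : 0 ≤ C₁ * D * a := by positivity
    refine ⟨he.trans h1, ?_⟩
    nlinarith
  obtain ⟨heu', hgu'⟩ := bound au qu eu gu hau hqu heu hgu
  obtain ⟨hev', hgv'⟩ := bound av qv ev gv hav hqv hev hgv
  set Nu := au + qu with hNu
  set Nv := av + qv with hNv
  have hNu0 : 0 ≤ Nu := by positivity
  have hNv0 : 0 ≤ Nv := by positivity
  have havN : av ≤ Nv := by linarith
  have t1 : M₀ * (eu * av) ≤ M₀ * (C₁ * h * Nu * Nv) := by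
    refine mul_le_mul_of_nonneg_left ?_ hM₀
    exact mul_le_mul heu' havN hav (by positivity)
  have t2 : M₀ * (gu * ev) ≤ M₀ * ((1 + C₁ * D) * Nu * (C₁ * h * Nv)) := by
    refine mul_le_mul_of_nonneg_left ?_ hM₀
    exact mul_le_mul hgu' hev' hev0 (by positivity)
  have t3 : C₂ * (M₁ * h) * (gu * gv) ≤
      C₂ * (M₁ * h) * ((1 + C₁ * D) * Nu * ((1 + C₁ * D) * Nv)) := by
    refine mul_le_mul_of_nonneg_left ?_ (by positivity)
    exact mul_le_mul hgu' hgv' hgv0 (by positivity)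
  have t4 : 0 ≤ (C₁ + (1 + C₁ * D) * C₁) * h * M₁ * (Nu * Nv) := by positivity
  have t5 : 0 ≤ C₂ * (1 + C₁ * D) ^ 2 * h * M₀ * (Nu * Nv) := by positivity
  nlinarith

/-- The consistency error on one element. -/
theorem abs_cell_error_le {σ M₀ M₁ D : ℝ} (hσ : 0 ≤ σ) (hT : T.ShapeRegular σ)
    (hΩ : IsLipschitzDomain Ω) (hK : K ∈ T.cells) (hD : cellDiam K ≤ D)
    (hu : MemH2 Ω u) (hv : MemH2 Ω v) (hw : MemLp w ⊤ (volume.restrict Ω))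
    (hM₀ : 0 ≤ M₀) (hM₁ : 0 ≤ M₁) (hwM : ∀ᵐ x ∂volume.restrict Ω, ‖w x‖ ≤ M₀)
    (hU : ∀ i ∈ K, ∫⁻ y in openCell K, ‖taylorRem Ω u (U i) i y‖ₑ ^ 2 ≤
        ENNReal.ofReal (4 * cellDiam K ^ 4) * ∫⁻ z in openCell K, ‖hessNorm Ω u z‖ₑ ^ 2)
    (hV : ∀ i ∈ K, ∫⁻ y in openCell K, ‖taylorRem Ω v (V i) i y‖ₑ ^ 2 ≤
        ENNReal.ofReal (4 * cellDiam K ^ 4) * ∫⁻ z in openCell K, ‖hessNorm Ω v z‖ₑ ^ 2)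
    (hww' : ∀ᵐ x ∂volume.restrict Ω, w' x = w x)
    (hlip : ∀ x ∈ convexHull ℝ (K : Set E), ∀ y ∈ convexHull ℝ (K : Set E),
      |w' x - w' y| ≤ M₁ * ‖x - y‖)
    (hW : ∀ i ∈ K, ∀ j ∈ K, i ≠ j → W i j = W j i ∧ W i j ∈ w' '' segment ℝ i j) :
    |(∫ x in openCell K, w x * inner ℝ (weakGrad Ω u x) (weakGrad Ω v x)) -
        volume.real (openCell K) *
          ∑ i ∈ K, ∑ j ∈ K, T.stiffness K i j * W i j * (U i * (V j - V i))| ≤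
      (2 * (d + 1) * σ + (1 + 2 * (d + 1) * σ * D) * (2 * (d + 1) * σ) +
          (d + 1) ^ 2 * σ ^ 2 * (1 + 2 * (d + 1) * σ * D) ^ 2) * cellDiam K * (M₀ + M₁) *
        ((lpNormOn (openCell K) 2 (weakGrad Ω u) + lpNormOn (openCell K) 2 (hessNorm Ω u)) *
          (lpNormOn (openCell K) 2 (weakGrad Ω v) + lpNormOn (openCell K) 2 (hessNorm Ω v))) := by
  have hr : volume.restrict (openCell K) ≤ volume.restrict Ω :=
    Measure.restrict_mono (openCell_subset_domain hΩ hK) le_rfl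
  have hfin : IsFiniteMeasure (volume.restrict (openCell K)) :=
    ⟨by simpa using measure_openCell_lt_top⟩
  have mu : MemLp (weakGrad Ω u) 2 (volume.restrict (openCell K)) :=
    (memLp_weakGrad fun i => (hu.2.1 i).2).mono_measure hr
  have mv : MemLp (weakGrad Ω v) 2 (volume.restrict (openCell K)) :=
    (memLp_weakGrad fun i => (hv.2.1 i).2).mono_measure hr
  have mw := hw.mono_measure hr
  have mc : ∀ c : E, MemLp (fun _ : E => c) 2 (volume.restrict (openCell K)) := fun c =>
    memLp_const c
  set Gu := T.interpGrad U K with hGu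
  set Gv := T.interpGrad V K with hGv
  have meu : MemLp (fun y => Gu - weakGrad Ω u y) 2 (volume.restrict (openCell K)) := (mc Gu).sub mu
  have mev : MemLp (fun y => Gv - weakGrad Ω v y) 2 (volume.restrict (openCell K)) := (mc Gv).sub mv
  have hwK : ∀ᵐ x ∂volume.restrict (openCell K), ‖w x‖ ≤ M₀ := ae_mono hr hwM
  have eu := lpNormOn_interpGrad_sub_le hT hΩ hu hK hU
  have ev := lpNormOn_interpGrad_sub_le hT hΩ hv hK hV
  have gu : lpNormOn (openCell K) 2 (fun _ => Gu) ≤ lpNormOn (openCell K) 2 (weakGrad Ω u) +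
      lpNormOn (openCell K) 2 (fun y => Gu - weakGrad Ω u y) := by
    have := lpNormOn_add_le mu meu
    rwa [show weakGrad Ω u + (fun y => Gu - weakGrad Ω u y) = fun _ => Gu by
      ext1 y; simp] at this
  have gv : lpNormOn (openCell K) 2 (fun _ => Gv) ≤ lpNormOn (openCell K) 2 (weakGrad Ω v) +
      lpNormOn (openCell K) 2 (fun y => Gv - weakGrad Ω v y) := by
    have := lpNormOn_add_le mv mev
    rwa [show weakGrad Ω v + (fun y => Gv - weakGrad Ω v y) = fun _ => Gv by
      ext1 y; simp] at this
  have b1 := abs_setIntegral_mul_inner_le hM₀ hwK meu mv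
  have b2 := abs_setIntegral_mul_inner_le hM₀ hwK (mc Gu) mev
  have b3 := abs_setIntegral_mul_inner_interpGrad_sub_le (U := U) (V := V) hT hK hM₁
    (mw.integrable le_top) (ae_mono hr hww') hlip hW
  rw [← hGu, ← hGv] at b3
  have hgg : volume.real (openCell K) * (‖Gu‖ * ‖Gv‖) =
      lpNormOn (openCell K) 2 (fun _ => Gu) * lpNormOn (openCell K) 2 (fun _ => Gv) := by
    rw [lpNormOn_const, lpNormOn_const]
    have := Real.mul_self_sqrt (measureReal_nonneg (μ := volume) (s := openCell K))
    linear_combination (-(‖Gu‖ * ‖Gv‖)) * this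
  rw [hgg] at b3
  -- With $G_u=\nabla u_h$ and $G_v=\nabla v_h$: $\nabla u\cdot\nabla v=G_u\cdot G_v-(G_u-\nabla
  -- u)\cdot\nabla v-G_u\cdot(G_v-\nabla v)$.
  have hsplit : ∫ x in openCell K, w x * inner ℝ (weakGrad Ω u x) (weakGrad Ω v x) =
      (∫ x in openCell K, w x * inner ℝ Gu Gv) -
        (∫ x in openCell K, w x * inner ℝ (Gu - weakGrad Ω u x) (weakGrad Ω v x)) -
        ∫ x in openCell K, w x * inner ℝ Gu (Gv - weakGrad Ω v x) := by
    have i1 : IntegrableOn (fun x => w x * inner ℝ Gu Gv -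
        w x * inner ℝ (Gu - weakGrad Ω u x) (weakGrad Ω v x)) (openCell K) :=
      (integrable_mul_inner mw (mc Gu) (mc Gv)).sub (integrable_mul_inner mw meu mv)
    rw [← integral_sub (integrable_mul_inner mw (mc Gu) (mc Gv)) (integrable_mul_inner mw meu mv),
      ← integral_sub i1 (integrable_mul_inner mw (mc Gu) mev)]
    refine integral_congr_ae (Eventually.of_forall fun x => ?_)
    simp only [inner_sub_left, inner_sub_right]
    ring
  have hfinal := cell_constant_le hM₀ hM₁ (cellDiam_nonneg (K := K)) hD
    (C₁ := 2 * (d + 1) * σ) (C₂ := (d + 1) ^ 2 * σ ^ 2) (by positivity) (by positivity)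
    (lpNormOn_nonneg _ _ _) (lpNormOn_nonneg _ _ _) (lpNormOn_nonneg _ _ _) (lpNormOn_nonneg _ _ _)
    (lpNormOn_nonneg _ _ _) (lpNormOn_nonneg _ _ _) eu ev gu gv
  refine le_trans ?_ hfinal
  rw [hsplit]
  rw [abs_le] at b1 b2 b3 ⊢
  constructor <;> linarith [b1.1, b1.2, b2.1, b2.2, b3.1, b3.2]

/-- The squares of $L^2$ norms add up over the cells; the factor $2$ comes from
$(a+b)^2\le2(a^2+b^2)$. -/
theorem sum_cell_norms_le (T : SimplicialMesh Ω) (hΩ : IsLipschitzDomain Ω) (hu : MemH2 Ω u) :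
    ∑ K ∈ T.cells, (lpNormOn (openCell K) 2 (weakGrad Ω u) +
      lpNormOn (openCell K) 2 (hessNorm Ω u)) ^ 2 ≤ 2 * normH2 Ω u ^ 2 := by
  have mu : MemLp (weakGrad Ω u) 2 (volume.restrict Ω) := memLp_weakGrad fun i => (hu.2.1 i).2
  have mh := memLp_hessNorm hu
  have hr : ∀ K ∈ T.cells, volume.restrict (openCell K) ≤ volume.restrict Ω := fun K hK =>
    Measure.restrict_mono (openCell_subset_domain hΩ hK) le_rfl
  have h1 : lpNormOn Ω 2 (weakGrad Ω u) ^ 2 =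
      ∑ K ∈ T.cells, lpNormOn (openCell K) 2 (weakGrad Ω u) ^ 2 := by
    rw [lpNormOn_sq mu, T.setIntegral_eq_sum hΩ (integrable_norm_sq mu)]
    exact Finset.sum_congr rfl fun K hK => (lpNormOn_sq (mu.mono_measure (hr K hK))).symm
  have h2 : lpNormOn Ω 2 (hessNorm Ω u) ^ 2 =
      ∑ K ∈ T.cells, lpNormOn (openCell K) 2 (hessNorm Ω u) ^ 2 := by
    rw [lpNormOn_sq mh, T.setIntegral_eq_sum hΩ (integrable_norm_sq mh)]
    exact Finset.sum_congr rfl fun K hK => (lpNormOn_sq (mh.mono_measure (hr K hK))).symm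
  refine le_trans ?_ (mul_le_mul_of_nonneg_left (lpNormOn_weakGrad_sq_add_hessNorm_sq hu) zero_le_two)
  rw [h1, h2, ← Finset.sum_add_distrib, Finset.mul_sum]
  exact Finset.sum_le_sum fun K _ => add_sq_le

theorem cellDiam_le_meshSize (hK : K ∈ T.cells) : cellDiam K ≤ T.meshSize :=
  le_ciSup (f := fun K : T.cells => diam (convexHull ℝ ((K : Finset E) : Set E)))
    (Set.finite_range _).bddAbove ⟨K, hK⟩

theorem cellDiam_le_diam (hΩ : IsLipschitzDomain Ω) (hK : K ∈ T.cells) :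
    cellDiam K ≤ diam (closure Ω) :=
  diam_mono (convexHull_subset_closure hK) hΩ.isBounded.closure

theorem ShapeRegular.abs {σ : ℝ} (hT : T.ShapeRegular σ) : T.ShapeRegular |σ| := by
  intro K hK
  obtain ⟨c, r, hr, hball, hdiam⟩ := hT K hK
  refine ⟨c, r, hr, hball, hdiam.trans ?_⟩
  gcongr
  exact le_abs_self σ

end SimplicialMesh

end

/-! ### Assembly of the cell estimates -/

open SimplicialMesh in
theorem mainTheorem8 (d : ℕ) (hd : d = 2 ∨ d = 3)
    (Ω : Set (EuclideanSpace ℝ (Fin d))) (hΩ : IsLipschitzDomain Ω) (σ : ℝ) :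
    ∃ C : ℝ, ∀ T : SimplicialMesh Ω, T.ShapeRegular σ → T.IsAcute →
      ∀ u v w : EuclideanSpace ℝ (Fin d) → ℝ, MemH2 Ω u → MemH2 Ω v → MemW1Inf Ω w →
        ∃ u' v' w' : EuclideanSpace ℝ (Fin d) → ℝ,
          IsContRep Ω u u' ∧ IsContRep Ω v v' ∧ IsContRep Ω w w' ∧
          ∀ W : EuclideanSpace ℝ (Fin d) → EuclideanSpace ℝ (Fin d) → ℝ,
            (∀ i ∈ T.nodes, ∀ j ∈ T.nodes, T.IsEdge i j →
              W i j = W j i ∧ W i j ∈ w' '' segment ℝ i j) →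
            ∃ R : ℝ,
              ∫ x in Ω, w x * inner ℝ (weakGrad Ω u x) (weakGrad Ω v x) =
                -(∑ i ∈ T.nodes, ∑ j ∈ T.nodes, u' i * T.coeff i j * W i j * (v' j - v' i)) + R ∧
              |R| ≤ C * T.meshSize * normW1Inf Ω w * normH2 Ω u * normH2 Ω v := by
  have hd3 : d ≤ 3 := by omega
  set D := Metric.diam (closure Ω) with hD
  have hD0 : 0 ≤ D := Metric.diam_nonneg
  set C₀ := 2 * (d + 1) * |σ| + (1 + 2 * (d + 1) * |σ| * D) * (2 * (d + 1) * |σ|) +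
    (d + 1) ^ 2 * |σ| ^ 2 * (1 + 2 * (d + 1) * |σ| * D) ^ 2 with hC₀
  have hC₀0 : 0 ≤ C₀ := by positivity
  -- The factor $2$ is the geometric mean of those of `sum_cell_norms_le` for $u$ and $v$. The
  -- constant $C_0$ involves only $d$, $|\sigma|$ and the diameter of $\overline\Omega$.
  refine ⟨2 * C₀, fun T hT hA u v w hu hv hw => ?_⟩
  obtain ⟨u', hu', hu'T⟩ := exists_isContRep_of_memH2 hd3 hΩ hu
  obtain ⟨v', hv', hv'T⟩ := exists_isContRep_of_memH2 hd3 hΩ hv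
  obtain ⟨w', hw', hw'L⟩ := exists_isContRep_of_memW1Inf hΩ hw
  -- The remainder is by definition the difference of the two sides, so only its bound is left.
  refine ⟨u', v', w', hu', hv', hw', fun W hW => ⟨_, (add_sub_cancel _ _).symm, ?_⟩⟩
  have mu : MemLp (weakGrad Ω u) 2 (volume.restrict Ω) := memLp_weakGrad fun i => (hu.2.1 i).2
  have mv : MemLp (weakGrad Ω v) 2 (volume.restrict Ω) := memLp_weakGrad fun i => (hv.2.1 i).2
  have hM₀ := lpNormOn_nonneg Ω ∞ w
  have hM₁ := lpNormOn_nonneg Ω ∞ (weakGrad Ω w)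
  rw [neg_sum_coeff_eq hA, T.setIntegral_eq_sum hΩ (integrable_mul_inner hw.1 mu mv),
    ← Finset.sum_sub_distrib]
  set N : (EuclideanSpace ℝ (Fin d) → ℝ) → Finset (EuclideanSpace ℝ (Fin d)) → ℝ := fun f K =>
    lpNormOn (openCell K) 2 (weakGrad Ω f) + lpNormOn (openCell K) 2 (hessNorm Ω f) with hN
  have hN0 : ∀ f K, 0 ≤ N f K := fun f K =>
    add_nonneg (lpNormOn_nonneg _ _ _) (lpNormOn_nonneg _ _ _)
  have hcell : ∀ K ∈ T.cells,
      |(∫ x in openCell K, w x * inner ℝ (weakGrad Ω u x) (weakGrad Ω v x)) -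
        volume.real (openCell K) *
          ∑ i ∈ K, ∑ j ∈ K, T.stiffness K i j * W i j * (u' i * (v' j - v' i))| ≤
      C₀ * T.meshSize * normW1Inf Ω w * (N u K * N v K) := by
    intro K hK
    have hcl := closure_openCell hK
    have hKΩ := openCell_subset_domain hΩ hK
    have hdiam : ∀ a ∈ openCell K, ∀ b ∈ openCell K, ‖a - b‖ ≤ cellDiam K := fun a ha b hb =>
      norm_sub_le_cellDiam (openCell_subset ha) (openCell_subset hb)
    have hmem : ∀ i ∈ K, i ∈ closure (openCell K) := fun i hi => by
      rw [hcl]; exact subset_convexHull ℝ _ hi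
    refine (abs_cell_error_le (abs_nonneg σ) hT.abs hΩ hK (cellDiam_le_diam hΩ hK) hu hv hw.1
      hM₀ hM₁ (ae_norm_le_lpNormOn_top hw.1)
      (fun i hi => hu'T _ hKΩ isOpen_openCell convex_openCell i (hmem i hi) _ hdiam)
      (fun i hi => hv'T _ hKΩ isOpen_openCell convex_openCell i (hmem i hi) _ hdiam) hw'.2
      (by
        have := hw'L _ hKΩ isOpen_openCell convex_openCell
        rwa [hcl] at this)
      (fun i hi j hj hij => hW i (subset_nodes hK hi) j (subset_nodes hK hj)
        ⟨hij, K, hK, hi, hj⟩)).trans ?_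
    have := mul_nonneg (hN0 u K) (hN0 v K)
    have := cellDiam_le_meshSize hK
    rw [normW1Inf]
    gcongr
  have hCS := Finset.sum_mul_sq_le_sq_mul_sq T.cells (N u) (N v)
  have hsum : ∑ K ∈ T.cells, N u K * N v K ≤ 2 * (normH2 Ω u * normH2 Ω v) := by
    refine abs_le_of_sq_le_sq' ?_ (mul_nonneg zero_le_two (mul_nonneg normH2_nonneg normH2_nonneg))
      |>.2
    refine hCS.trans ((mul_le_mul (T.sum_cell_norms_le hΩ hu) (T.sum_cell_norms_le hΩ hv)
      (Finset.sum_nonneg fun K _ => sq_nonneg _) (by positivity)).trans (le_of_eq ?_))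
    ring
  have hmesh : 0 ≤ T.meshSize := Real.iSup_nonneg fun K => Metric.diam_nonneg
  have hwn : 0 ≤ normW1Inf Ω w := add_nonneg hM₀ hM₁
  calc _ ≤ ∑ K ∈ T.cells, C₀ * T.meshSize * normW1Inf Ω w * (N u K * N v K) :=
        (Finset.abs_sum_le_sum_abs _ _).trans (Finset.sum_le_sum hcell)
    _ = C₀ * T.meshSize * normW1Inf Ω w * ∑ K ∈ T.cells, N u K * N v K := by
        rw [Finset.mul_sum]
    _ ≤ C₀ * T.meshSize * normW1Inf Ω w * (2 * (normH2 Ω u * normH2 Ω v)) := by gcongr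
    _ = _ := by ring
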